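/- **Notation.** $(a)_0=1$ and $(a)_k=a(a+1)\cdots(a+k-1)$; $${}_pF_q\!\left({a_1,\dots,a_p\atop b_1,\dots,b_q};z\right)=\sum_{k\ge 0}\frac{(a_1)_k\cdots(a_p)_k}{(b_1)_k\cdots(b_q)_k\,k!}z^k .$$ For $f$ supported on $[-1,1]$ its Fourier transform is $\hat f(w)=\int_{-1}^{1}e^{-iwt}f(t)\,dt$, $w\in\mathbb R$. All functions below are defined on $[-1,1]$ and extended by $0$. * For $i\ge 2$ let $\phi_i(t)=(1-t^2)\,p_{i-2}(t)$, where $p_j$ is the monic polynomial of degree $j$ that is orthogonal on $[-1,1]$ with respect to the weight $(1-t^2)^2$ to all polynomials of lower degree (the monic ultraspherical polynomial $p_j^{5/2}$). * Let $A^n$ be the space of polynomials of degree at most $n$ on $[-1,1]$ that vanish at $\pm1$, and let $P^{n}$ be the orthogonal projection onto $A^n$ in $L^2$. * Let $r_0^n=(I-P^{n})(1+t)$ and $l_0^n(t)=r_0^n(-t)$. * For $m\ge1$ let $\bar u_m(t)=1-|t|t^{m-1}$ if $m$ is odd and $\bar u_m(t)=t-|t|t^{m-1}$ if $m$ is even,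 and for $n\ge m\ge 1$ let $u^0_{n,n-m}=(I-P^{n})\bar u_m$. **Theorem.** Let $w\in\mathbb R$ and $\epsilon\in\{0,1\}$. (1) For every integer $n\ge1$ the Fourier transform of $\phi_{2n+\epsilon}$ is $$\begin{aligned}\hat\phi_{2n+\epsilon}(w)={}&\frac{(-i)^{\epsilon}(n-1)!}{(n-\frac12+\epsilon)_{n+1}}\cos\left(w-\epsilon\tfrac{\pi}{2}\right)\\&+\frac{(-1)^n(-i)^\epsilon(n-1)!}{(n-\frac12+\epsilon)_{n+1}(\frac12)_{2n+2+\epsilon}}\left(\tfrac w2\right)^{2n+2+\epsilon}{}_0F_1\!\left({-\atop 2n+\frac52+\epsilon};-\left(\tfrac w2\right)^2\right)\\&+\frac{(-1)^{n-1}(-i)^\epsilon(n-1)!\,(n+1)(n+\frac12+\epsilon)}{(n-\frac12+\epsilon)_{n+1}(\frac12)_{2n+1+\epsilon}}\left(\tfrac w2\right)^{2n+\epsilon}{}_0F_1\!\left({-\atop 2n+\frac32+\epsilon};-\left(\tfrac w2\right)^2\right).\end{aligned}$$ (2) For every integer $n\ge1$ the Fourier transform of $l_0^n$ is $$\hat l_0^n(w)=\frac{4}{n(n+2)}e^{iw}-\frac{4(-1)^ne^{-iw}}{n(n+1)(n+2)}-\frac{4(n-1)!\,(2iw)^{n+1}e^{-iw}}{(2n+2)!}\,{}_2F_2\!\left({n+1,\;n+3\atop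 n+2,\;2n+3};2iw\right).$$ (3) For all integers $n\ge m\ge0$ the Fourier transform of $u^0_{2n+1+\epsilon,\,2n-2m}$ is $$\begin{aligned}\hat u^{\epsilon}_{m,n}(w)={}&-(-iw)^\epsilon\frac{(-m-\frac12)_{n+1}}{(m+\epsilon+1)_{n+2}(\frac12+\epsilon)_{2n+2}}\left(\tfrac w2\right)^{2n+2}{}_1F_2\!\left({n+m+\epsilon+2\atop n+m+\epsilon+3,\;2n+\frac52+\epsilon};-\left(\tfrac w2\right)^2\right)\\&-(-iw)^\epsilon\frac{(-1)^n(-m-\frac12)_{n+1}}{(m+1+\epsilon)_{n+1}(n+1)(\frac12+\epsilon+n)}\,{}_0F_1\!\left({-\atop\frac12+\epsilon};-\left(\tfrac w2\right)^2\right)\\&-(-iw)^\epsilon\frac{(-m-\frac12)_{n+1}}{(n+1)(\frac12+\epsilon+n)(m+1+\epsilon)_{n+1}(\frac12+\epsilon)_{2n+2}}\left(\tfrac w2\right)^{2n+2}{}_0F_1\!\left({-\atop 2n+\frac52+\epsilon};-\left(\tfrac w2\right)^2\right).\end{aligned}$$ -/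

import Mathlib

open MeasureTheory Set Complex

noncomputable section

namespace Ramp

/-! ### Monic Jacobi polynomials -/

/-- The Jacobi weight `(1 - x)^α (1 + x)^β`. -/
def jacobiWeight (α β x : ℝ) : ℝ := (1 - x) ^ α * (1 + x) ^ β

/-- `p` is the monic Jacobi polynomial of degree `n`: it is monic of degree `n` and orthogonal on
`[-1, 1]`, with respect to the weight `(1 - x)^α (1 + x)^β`, to `x^i` for all `i < n`. -/
def IsMonicJacobi (α β : ℝ) (n : ℕ) (p : Polynomial ℝ) : Prop :=
  p.Monic ∧ p.natDegree = n ∧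
    ∀ i < n, ∫ x in (-1 : ℝ)..1, p.eval x * x ^ i * jacobiWeight α β x = 0

theorem intervalIntegrable_jacobiWeight {α β : ℝ} (hα : -1 < α) (hβ : -1 < β) :
    IntervalIntegrable (jacobiWeight α β) volume (-1) 1 := by
  have h1 : IntervalIntegrable (jacobiWeight α β) volume (-1) 0 := by
    have h : IntervalIntegrable (fun x : ℝ => (1 + x) ^ β) volume (-1) 0 := by
      have := (intervalIntegral.intervalIntegrable_rpow' (a := 0) (b := 1) hβ).comp_add_left 1
      simpa using this
    refine h.continuousOn_mul (f := fun x : ℝ => (1 + x) ^ β) (g := fun x : ℝ => (1 - x) ^ α) ?_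
    refine ContinuousOn.rpow_const (by fun_prop) ?_
    intro x hx
    left
    rw [uIcc_of_le (by norm_num)] at hx
    have := hx.2
    intro h
    linarith
  have h2 : IntervalIntegrable (jacobiWeight α β) volume 0 1 := by
    have h : IntervalIntegrable (fun x : ℝ => (1 - x) ^ α) volume 0 1 := by
      have := (intervalIntegral.intervalIntegrable_rpow' (a := 1) (b := 0) hα).comp_sub_left 1
      simpa using this
    refine h.mul_continuousOn (f := fun x : ℝ => (1 - x) ^ α) (g := fun x : ℝ => (1 + x) ^ β) ?_
    refine ContinuousOn.rpow_const (by fun_prop) ?_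
    intro x hx
    left
    rw [uIcc_of_le (by norm_num)] at hx
    have := hx.1
    intro h
    linarith
  exact h1.trans h2

theorem intervalIntegrable_mul_jacobiWeight {α β : ℝ} (hα : -1 < α) (hβ : -1 < β)
    {f : ℝ → ℝ} (hf : Continuous f) :
    IntervalIntegrable (fun x => f x * jacobiWeight α β x) volume (-1) 1 :=
  (intervalIntegrable_jacobiWeight hα hβ).continuousOn_mul hf.continuousOn

/-- The weighted integral `p ↦ ∫ p w` as a linear functional. -/
def jacobiFunctional {α β : ℝ} (hα : -1 < α) (hβ : -1 < β) : Polynomial ℝ →ₗ[ℝ] ℝ where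
  toFun p := ∫ x in (-1 : ℝ)..1, p.eval x * jacobiWeight α β x
  map_add' p q := by
    rw [← intervalIntegral.integral_add
      (intervalIntegrable_mul_jacobiWeight hα hβ p.continuous)
      (intervalIntegrable_mul_jacobiWeight hα hβ q.continuous)]
    simp [add_mul]
  map_smul' c p := by
    simp [mul_assoc]

theorem jacobiFunctional_sq_pos {α β : ℝ} (hα : -1 < α) (hβ : -1 < β) {q : Polynomial ℝ}
    (hq : q ≠ 0) : 0 < jacobiFunctional hα hβ (q * q) := by
  have hw : ∀ x ∈ Ioo (-1 : ℝ) 1, 0 < jacobiWeight α β x := fun x hx =>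
    mul_pos (Real.rpow_pos_of_pos (by linarith [hx.2]) _)
      (Real.rpow_pos_of_pos (by linarith [hx.1]) _)
  change 0 < ∫ x in (-1 : ℝ)..1, (q * q).eval x * jacobiWeight α β x
  rw [intervalIntegral.integral_pos_iff_support_of_nonneg_ae' ?_
    (intervalIntegrable_mul_jacobiWeight hα hβ (q * q).continuous)]
  · refine ⟨by norm_num, ?_⟩
    have hsub : Ioo (-1 : ℝ) 1 \ (q.roots.toFinset : Set ℝ) ⊆
        (Function.support fun x => (q * q).eval x * jacobiWeight α β x) ∩ Ioc (-1) 1 := by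
      intro x hx
      refine ⟨?_, hx.1.1, hx.1.2.le⟩
      have h1 : q.eval x ≠ 0 := by
        intro h
        exact hx.2 (by simp [hq, h])
      have h2 := (hw x hx.1).ne'
      simp [h1, h2]
    refine lt_of_lt_of_le ?_ (measure_mono hsub)
    rw [measure_sdiff_null (Finset.measure_zero _ _)]
    simp
  · rw [uIoc_of_le (by norm_num)]
    filter_upwards [ae_restrict_mem measurableSet_Ioc] with x hx
    have h1 : 0 ≤ jacobiWeight α β x :=
      mul_nonneg (Real.rpow_nonneg (by linarith [hx.2]) _)
        (Real.rpow_nonneg (by linarith [hx.1]) _)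
    simpa using mul_nonneg (mul_self_nonneg (q.eval x)) h1

/-- For `α, β > -1` there is exactly one monic Jacobi polynomial of each degree. -/
theorem existsUnique_isMonicJacobi {α β : ℝ} (hα : -1 < α) (hβ : -1 < β) (n : ℕ) :
    ∃! p : Polynomial ℝ, IsMonicJacobi α β n p := by
  set L := jacobiFunctional hα hβ with hL
  have hLd : ∀ p : Polynomial ℝ, ∀ i : ℕ, L (p * Polynomial.X ^ i) =
      ∫ x in (-1 : ℝ)..1, p.eval x * x ^ i * jacobiWeight α β x := by
    intro p i
    change (∫ x in (-1 : ℝ)..1, (p * Polynomial.X ^ i).eval x * jacobiWeight α β x) = _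
    simp
  -- a polynomial of degree `< n` orthogonal to all lower powers vanishes
  have key : ∀ q ∈ Polynomial.degreeLT ℝ n,
      (∀ i < n, L (q * Polynomial.X ^ i) = 0) → q = 0 := by
    intro q hqd hq
    by_contra hne
    have hpos := jacobiFunctional_sq_pos hα hβ hne
    have hdeg : q.natDegree < n := by
      rw [Polynomial.natDegree_lt_iff_degree_lt hne]
      exact Polynomial.mem_degreeLT.1 hqd
    have h0 : L (q * q) = 0 := by
      have hs : q * q =
          ∑ i ∈ Finset.range n, q.coeff i • (q * Polynomial.X ^ i) := by
        conv_lhs => rw [q.as_sum_range' n hdeg]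
        rw [← q.as_sum_range' n hdeg, Finset.sum_congr rfl (fun i _ =>
          (mul_smul_comm (q.coeff i) q (Polynomial.X ^ i)).symm), ← Finset.mul_sum]
        congr 1
        conv_lhs => rw [q.as_sum_range' n hdeg]
        refine Finset.sum_congr rfl fun i _ => ?_
        rw [Polynomial.smul_eq_C_mul, Polynomial.C_mul_X_pow_eq_monomial]
      rw [hs, map_sum]
      refine Finset.sum_eq_zero fun i hi => ?_
      rw [map_smul, hq i (Finset.mem_range.1 hi), smul_zero]
    rw [← hL] at hpos
    linarith
  let T : Polynomial.degreeLT ℝ n →ₗ[ℝ] (Fin n → ℝ) :=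
    LinearMap.pi fun i =>
      L ∘ₗ (LinearMap.mulRight ℝ (Polynomial.X ^ (i : ℕ))) ∘ₗ (Polynomial.degreeLT ℝ n).subtype
  have hT : ∀ q i, T q i = L ((q : Polynomial ℝ) * Polynomial.X ^ (i : ℕ)) := fun q i => rfl
  have hinj : Function.Injective T := by
    rw [injective_iff_map_eq_zero]
    intro q hq
    apply Subtype.ext
    refine key q q.2 fun i hi => ?_
    rw [← hT q ⟨i, hi⟩, hq]
    rfl
  have hsurj : Function.Surjective T := by
    have : FiniteDimensional ℝ (Polynomial.degreeLT ℝ n) :=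
      (Polynomial.degreeLTEquiv ℝ n).symm.finiteDimensional
    refine (LinearMap.injective_iff_surjective_of_finrank_eq_finrank ?_).1 hinj
    rw [(Polynomial.degreeLTEquiv ℝ n).finrank_eq]
  obtain ⟨q, hq⟩ := hsurj fun i => -L (Polynomial.X ^ n * Polynomial.X ^ (i : ℕ))
  have hqdeg : (q : Polynomial ℝ).degree < n := Polynomial.mem_degreeLT.1 q.2
  refine ⟨Polynomial.X ^ n + (q : Polynomial ℝ), ⟨Polynomial.monic_X_pow_add hqdeg, ?_, ?_⟩, ?_⟩
  · apply Polynomial.natDegree_eq_of_degree_eq_some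
    rw [Polynomial.degree_add_eq_left_of_degree_lt] <;> simp [hqdeg]
  · intro i hi
    have := congrFun hq ⟨i, hi⟩
    rw [hT] at this
    rw [← hLd, add_mul, map_add, this]
    simp
  · rintro p ⟨hpm, hpd, hp⟩
    have hmem : p - (Polynomial.X ^ n + (q : Polynomial ℝ)) ∈ Polynomial.degreeLT ℝ n := by
      have h1 : p - Polynomial.X ^ n ∈ Polynomial.degreeLT ℝ n := by
        rw [Polynomial.mem_degreeLT]
        have hdeg : p.degree = n := by
          rw [Polynomial.degree_eq_natDegree hpm.ne_zero, hpd]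
        rw [← hdeg]
        refine Polynomial.degree_sub_lt_left ?_ hpm.ne_zero ?_
        · rw [hdeg, Polynomial.degree_X_pow]
        · rw [hpm.leadingCoeff]
          simp
      have := Submodule.sub_mem _ h1 q.2
      rwa [sub_sub] at this
    refine sub_eq_zero.1 (key _ hmem fun i hi => ?_)
    have h1 := congrFun hq ⟨i, hi⟩
    rw [hT] at h1
    have h2 := hp i hi
    rw [← hLd] at h2
    rw [sub_mul, add_mul, map_sub, map_add, h2, h1]
    simp

open Classical in
/-- The monic Jacobi polynomial `p_n^{α,β}`, for `α, β > -1`. -/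
def monicJacobi (α β : ℝ) (n : ℕ) : Polynomial ℝ :=
  if h : ∃ p, IsMonicJacobi α β n p then h.choose else 0

theorem isMonicJacobi_monicJacobi {α β : ℝ} (hα : -1 < α) (hβ : -1 < β) (n : ℕ) :
    IsMonicJacobi α β n (monicJacobi α β n) := by
  have h : ∃ p, IsMonicJacobi α β n p := (existsUnique_isMonicJacobi hα hβ n).exists
  rw [monicJacobi, dif_pos h]
  exact h.choose_spec

/-- The monic ultraspherical polynomial `p_n^λ`, for `λ > -1/2`. -/
def ultraspherical (lam : ℝ) (n : ℕ) : Polynomial ℝ := monicJacobi (lam - 1 / 2) (lam - 1 / 2) n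

/-! ### The functions on `[-1, 1]`, extended by zero to the real line -/

/-- The bubble function `φ_i(t) = (1 - t²) p_{i-2}^{5/2}(t)` on `[-1, 1]` for `i ≥ 2`, and
`φ_i = 0` for `i < 2`. -/
def bubble (i : ℕ) : ℝ → ℝ :=
  if 2 ≤ i then
    (Icc (-1 : ℝ) 1).indicator fun t => (1 - t ^ 2) * (ultraspherical (5 / 2) (i - 2)).eval t
  else 0

theorem memLp_indicator {f : ℝ → ℝ} (hf : Continuous f) :
    MemLp ((Icc (-1 : ℝ) 1).indicator f) 2 volume := by
  rw [memLp_indicator_iff_restrict measurableSet_Icc]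
  obtain ⟨C, hC⟩ := isCompact_Icc.exists_bound_of_continuousOn (hf.continuousOn (s := Icc (-1) 1))
  refine MemLp.of_bound hf.aestronglyMeasurable C ?_
  filter_upwards [ae_restrict_mem measurableSet_Icc] with x hx using hC x hx

/-- The class in `L²(ℝ)` of the function equal to `f` on `[-1, 1]` and to `0` elsewhere. -/
def cutL2 (f : ℝ → ℝ) (hf : Continuous f) : Lp ℝ 2 (volume : Measure ℝ) :=
  (memLp_indicator hf).toLp _

/-- Cutting a polynomial off outside `[-1, 1]`, as a linear map into `L²(ℝ)`. -/
def polyL2 : Polynomial ℝ →ₗ[ℝ] Lp ℝ 2 (volume : Measure ℝ) where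
  toFun p := cutL2 (fun t => p.eval t) p.continuous
  map_add' p q := by
    rw [cutL2, cutL2, cutL2, ← MemLp.toLp_add]
    congr 1
    ext t
    by_cases h : t ∈ Icc (-1 : ℝ) 1 <;> simp [h]
  map_smul' c p := by
    rw [RingHom.id_apply, cutL2, cutL2, ← MemLp.toLp_const_smul]
    congr 1
    ext t
    by_cases h : t ∈ Icc (-1 : ℝ) 1 <;> simp [h]

/-- The polynomials of degree at most `n` which vanish at `-1` and at `1`. -/
def bubblePoly (n : ℕ) : Submodule ℝ (Polynomial ℝ) :=
  Polynomial.degreeLE ℝ n ⊓ LinearMap.ker (Polynomial.leval (-1 : ℝ)) ⊓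
    LinearMap.ker (Polynomial.leval (1 : ℝ))

/-- The space `A^n` of the continuous functions on the line which vanish outside `[-1, 1]` and
which agree on `[-1, 1]` with a polynomial of degree at most `n`, as a subspace of `L²(ℝ)`. -/
def bubbleSpace (n : ℕ) : Submodule ℝ (Lp ℝ 2 (volume : Measure ℝ)) :=
  (bubblePoly n).map polyL2

instance (n : ℕ) : FiniteDimensional ℝ (bubbleSpace n) := by
  have h1 : FiniteDimensional ℝ (Polynomial.degreeLT ℝ (n + 1)) :=
    (Polynomial.degreeLTEquiv ℝ (n + 1)).symm.finiteDimensional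
  have h2 : FiniteDimensional ℝ (bubblePoly n) := by
    refine Submodule.finiteDimensional_of_le (S₂ := Polynomial.degreeLT ℝ (n + 1)) ?_
    intro p hp
    have := Polynomial.mem_degreeLE.1 hp.1.1
    rw [Polynomial.mem_degreeLT]
    exact lt_of_le_of_lt this (by exact_mod_cast Nat.lt_succ_self n)
  unfold bubbleSpace
  infer_instance

/-- `(I - P^n) g`, where `P^n` is the orthogonal projection of `L²(ℝ)` onto `A^n`. -/
def subProj (n : ℕ) (g : Lp ℝ 2 (volume : Measure ℝ)) : Lp ℝ 2 (volume : Measure ℝ) :=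
  g - (bubbleSpace n).starProjection g

/-- The right ramp `r^n_0 = (I - P^n) r_0^0`, where `r_0^0(t) = 1 + t` on `[-1, 1]`. -/
def rightRamp (n : ℕ) : Lp ℝ 2 (volume : Measure ℝ) :=
  subProj n (cutL2 (fun t => 1 + t) (by fun_prop))

/-- The left ramp `l^n_0(t) = r^n_0(-t)`. -/
def leftRamp (n : ℕ) (t : ℝ) : ℝ := rightRamp n (-t)

/-- `1 - |t| t^(m-1)` for odd `m`, and `t - |t| t^(m-1)` for even `m ≥ 2`. -/
def uBarFormula (m : ℕ) (t : ℝ) : ℝ :=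
  (if Odd m then 1 else t) - |t| * t ^ (m - 1)

theorem continuous_uBarFormula (m : ℕ) : Continuous (uBarFormula m) := by
  unfold uBarFormula
  split_ifs <;> fun_prop

/-- `ū_m`, for `m ≥ 1`. -/
def uBar (m : ℕ) : Lp ℝ 2 (volume : Measure ℝ) :=
  cutL2 (uBarFormula m) (continuous_uBarFormula m)

/-- `u^0_{n,j}` for `j < n`; that is, `u^0_{n,n-m} = (I - P^n) ū_m` for `1 ≤ m ≤ n`. -/
def uZero (n j : ℕ) : Lp ℝ 2 (volume : Measure ℝ) := subProj n (uBar (n - j))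

/-! ### Fourier transforms and hypergeometric functions -/

/-- The Fourier transform `∫ e^{-iwt} f(t) dt`. -/
def fourierT (f : ℝ → ℝ) (w : ℝ) : ℂ := ∫ t : ℝ, cexp (-I * w * t) * (f t : ℂ)

/-- The Pochhammer symbol `(a)_k = a (a + 1) ⋯ (a + k - 1)`. -/
def poch (a : ℂ) (k : ℕ) : ℂ := ∏ i ∈ Finset.range k, (a + i)

/-- The hypergeometric series `pFq(a₁, …, a_p; b₁, …, b_q; z)`. -/
def hyperF (a b : List ℂ) (z : ℂ) : ℂ :=
  ∑' k : ℕ, (a.map fun x => poch x k).prod / ((b.map fun x => poch x k).prod * poch 1 k) * z ^ k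

end Ramp

end

open Ramp

/-! The proof rests on moments. For a combination of powers of `t`, possibly with one term `|t| t ^
j`, the moments of matching parity are a rational function of their index `k`: each term contributes
a simple pole, with its coefficient as residue up to a fixed factor. Orthogonality is also a
condition on moments. A polynomial of given parity that vanishes at `±1` has coefficients with sum
zero, so a function of that parity is orthogonal to all of them up to some degree as soon as its
moments of that parity are constant up to that degree. For the bubble functions, orthogonality of
`p` for the weight `(1 - t²)²` says that successive moments of `(1 - t²) p` of the same parity
agree, which is again constancy.

The moments must therefore be `K (1 - ∏ (k - b j) / ∏ (k + a j))`. The poles `-a j` are dictated by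
the powers that occur, and the zeros `b j` by the range of constancy, except for at most one zero.
That zero and `K` follow from the boundary values and, when needed, one normalised coefficient.
`exists_partialFraction` supplies both inputs: the sum of the residues and each single residue. The
proof runs backwards: it writes down this rational function, reads off the coefficients, and
identifies the resulting function by uniqueness of monic orthogonal polynomials or of orthogonal
projections (`exists_bubble_eq`, `exists_rightRamp_eq`, `exists_uZero_eq`).

The Fourier transform is the exponential generating series of the moments (`hasSum_integral_exp`).
The constant `K` sums to a cosine, an exponential or a `₀F₁`. The product term vanishes at its
prescribed zeros, so its series starts at a high power of `w` (after a lone `k = 0` term for the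
ramps), and shifting the index turns it into a hypergeometric series. The ramps have no parity; they
are treated in the variable `s = (1 + t) / 2`. -/

namespace Ramp

/-! ### Partial fractions -/

/-- The partial fraction expansion of `1 - ∏ (x - b j) / ∏ (x + a j)` for distinct `a j`, with the
sum of its coefficients and a formula for each coefficient. -/
theorem exists_partialFraction {ι : Type*} [DecidableEq ι] (s : Finset ι) (a b : ι → ℝ)
    (ha : Set.InjOn a s) :
    ∃ c : ι → ℝ,
      (∀ x : ℝ, (∀ j ∈ s, x + a j ≠ 0) →
        ∑ j ∈ s, c j / (x + a j) = 1 - (∏ j ∈ s, (x - b j)) / ∏ j ∈ s, (x + a j)) ∧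
      ∑ j ∈ s, c j = ∑ j ∈ s, (a j + b j) ∧
      ∀ j ∈ s, c j * ∏ i ∈ s.erase j, (a i - a j) = -∏ i ∈ s, (-a j - b i) := by
  rcases s.eq_empty_or_nonempty with rfl | hs
  · exact ⟨0, by simp⟩
  set v : ι → ℝ := fun j => -a j with hv
  have hvs : Set.InjOn v s := fun i hi j hj h => ha hi hj (neg_injective h)
  set A : Polynomial ℝ := ∏ j ∈ s, (Polynomial.X - Polynomial.C (v j)) with hA
  set B : Polynomial ℝ := ∏ j ∈ s, (Polynomial.X - Polynomial.C (b j)) with hB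
  have hAm : A.Monic := Polynomial.monic_prod_X_sub_C v s
  have hBm : B.Monic := Polynomial.monic_prod_X_sub_C b s
  have hAd : A.degree = s.card := by
    rw [Polynomial.degree_eq_natDegree hAm.ne_zero, hA,
      Polynomial.natDegree_finsetProd_X_sub_C_eq_card]
  have hBd : B.degree = s.card := by
    rw [Polynomial.degree_eq_natDegree hBm.ne_zero, hB,
      Polynomial.natDegree_finsetProd_X_sub_C_eq_card]
  have hdeg : (A - B).degree < s.card := by
    rw [← hAd]
    refine Polynomial.degree_sub_lt_left (by rw [hAd, hBd]) hAm.ne_zero ?_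
    rw [hAm.leadingCoeff, hBm.leadingCoeff]
  have hAe : ∀ x, A.eval x = ∏ j ∈ s, (x + a j) := fun x => by
    simp [hA, Polynomial.eval_prod, hv]
  have hBe : ∀ x, B.eval x = ∏ j ∈ s, (x - b j) := fun x => by
    simp [hB, Polynomial.eval_prod]
  have hA0 : ∀ j ∈ s, A.eval (v j) = 0 := fun j hj => by
    rw [hAe]
    exact Finset.prod_eq_zero hj (by simp [hv])
  -- The witness is the residue of `(A - B) / A` at `-a j`. As `A - B` has degree below the number
  -- of nodes, it is its own Lagrange interpolant, and the barycentric form of that interpolant is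
  -- the expansion.
  refine ⟨fun j => (A - B).eval (v j) / ∏ i ∈ s.erase j, (v j - v i), ?_, ?_, ?_⟩
  · intro x hx
    have h1 := Lagrange.eval_interpolate_not_at_node (s := s) (v := v)
      (fun i => (A - B).eval (v i)) (x := x) (fun i hi h => hx i hi (by simp [h, hv]))
    rw [← Lagrange.eq_interpolate hvs hdeg, Lagrange.eval_nodal, Polynomial.eval_sub, hAe, hBe] at h1
    have h2 : ∏ j ∈ s, (x - v j) = ∏ j ∈ s, (x + a j) := by simp [hv]
    have h3 : ∏ j ∈ s, (x + a j) ≠ 0 := Finset.prod_ne_zero_iff.2 hx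
    rw [h2] at h1
    have h4 : ∑ j ∈ s, (A - B).eval (v j) / (∏ i ∈ s.erase j, (v j - v i)) / (x + a j) =
        ∑ i ∈ s, Lagrange.nodalWeight s v i * (x - v i)⁻¹ * (A - B).eval (v i) := by
      refine Finset.sum_congr rfl fun j _ => ?_
      rw [Lagrange.nodalWeight, Finset.prod_inv_distrib]
      simp only [hv, sub_neg_eq_add]
      ring
    rw [h4, eq_sub_iff_add_eq', ← eq_sub_iff_add_eq, div_eq_iff h3, sub_mul, one_mul,
      mul_comm _ (∏ j ∈ s, (x + a j)), ← h1]
    ring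
  -- The residues add up to the coefficient of `A - B` just below the cancelled top degree, which
  -- Vieta's formula gives.
  · rw [← Lagrange.coeff_eq_sum hvs hdeg, Polynomial.coeff_sub, hA, hB,
      Polynomial.prod_X_sub_C_coeff_card_pred s v hs.card_pos,
      Polynomial.prod_X_sub_C_coeff_card_pred s b hs.card_pos, Finset.sum_add_distrib]
    simp [hv]
  · intro j hj
    have h1 : ∏ i ∈ s.erase j, (v j - v i) = ∏ i ∈ s.erase j, (a i - a j) :=
      Finset.prod_congr rfl fun i _ => by simp only [hv]; ring
    have h2 : ∏ i ∈ s.erase j, (a i - a j) ≠ 0 := by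
      refine Finset.prod_ne_zero_iff.2 fun i hi => sub_ne_zero.2 fun h => ?_
      exact Finset.ne_of_mem_erase hi (ha (Finset.mem_of_mem_erase hi) hj h)
    simp only [h1]
    rw [div_mul_cancel₀ _ h2, Polynomial.eval_sub, hA0 j hj, hBe, zero_sub]

/-! ### Pochhammer symbols and hypergeometric series -/

theorem poch_succ (a : ℂ) (k : ℕ) : poch a (k + 1) = poch a k * (a + k) :=
  Finset.prod_range_succ _ _

theorem poch_add (a : ℂ) (k l : ℕ) : poch a (k + l) = poch a k * poch (a + k) l := by
  rw [poch, Finset.prod_range_add]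
  simp [poch, add_assoc]

theorem poch_succ' (a : ℂ) (k : ℕ) : poch a (k + 1) = a * poch (a + 1) k := by
  rw [add_comm k 1, poch_add]
  simp [poch]

theorem poch_natCast (a k : ℕ) : poch ((a : ℂ) + 1) k * (a.factorial : ℂ) = (a + k).factorial := by
  induction k with
  | zero => simp [poch]
  | succ k ih =>
    rw [poch_succ, ← add_assoc, Nat.factorial_succ]
    push_cast
    rw [← ih]
    ring

theorem poch_one (k : ℕ) : poch 1 k = (k.factorial : ℂ) := by
  simpa using poch_natCast 0 k

theorem poch_ne_zero {a : ℝ} (ha : 0 < a) (k : ℕ) : poch (a : ℂ) k ≠ 0 := by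
  refine Finset.prod_ne_zero_iff.2 fun i _ => ?_
  have : (a : ℝ) + i ≠ 0 := by positivity
  exact_mod_cast this

/-- Comparing the factors of numerator and denominator one index at a time bounds the `k`-th term by
`(|M| ‖z‖) ^ k / k!`, so the exponential series dominates. -/
theorem hasSum_hyperF (a b : List ℂ) (z : ℂ) (M : ℝ)
    (h : ∀ i : ℕ, (a.map fun x : ℂ => ‖x + (i : ℂ)‖).prod ≤
      M * (b.map fun x : ℂ => ‖x + (i : ℂ)‖).prod) :
    HasSum (fun k : ℕ => (a.map fun x => poch x k).prod /
      ((b.map fun x => poch x k).prod * k.factorial) * z ^ k) (hyperF a b z) := by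
  have hn : ∀ (l : List ℂ) (k : ℕ), ‖(l.map fun x => poch x k).prod‖ =
      ∏ i ∈ Finset.range k, (l.map fun x : ℂ => ‖x + (i : ℂ)‖).prod := by
    intro l k
    induction l with
    | nil => simp
    | cons x l ih =>
      rw [List.map_cons, List.prod_cons, norm_mul, ih, poch, norm_prod]
      simp [Finset.prod_mul_distrib]
  have hnn : ∀ (l : List ℂ) (i : ℕ), 0 ≤ (l.map fun x : ℂ => ‖x + (i : ℂ)‖).prod := fun l i => by
    induction l with
    | nil => simp
    | cons x l ih => simpa using mul_nonneg (norm_nonneg _) ih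
  have hs : Summable (fun k : ℕ => (a.map fun x => poch x k).prod /
      ((b.map fun x => poch x k).prod * k.factorial) * z ^ k) := by
    refine Summable.of_norm_bounded (Real.summable_pow_div_factorial (|M| * ‖z‖)) fun k => ?_
    have h1 : ‖(a.map fun x => poch x k).prod‖ ≤ |M| ^ k * ‖(b.map fun x => poch x k).prod‖ := by
      rw [hn, hn]
      calc _ ≤ ∏ i ∈ Finset.range k, (|M| * (b.map fun x : ℂ => ‖x + (i : ℂ)‖).prod) :=
            Finset.prod_le_prod (fun i _ => hnn a i) fun i _ => (h i).trans
              (mul_le_mul_of_nonneg_right (le_abs_self M) (hnn b i))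
        _ = _ := by rw [Finset.prod_mul_distrib]; simp
    have h2 : ‖(a.map fun x => poch x k).prod‖ / ‖(b.map fun x => poch x k).prod‖ ≤ |M| ^ k :=
      div_le_of_le_mul₀ (norm_nonneg _) (by positivity) h1
    rw [norm_mul, norm_div, norm_mul, norm_pow, mul_pow, ← div_div]
    simp only [Complex.norm_natCast]
    rw [mul_div_right_comm]
    gcongr
  have he : hyperF a b z = ∑' k : ℕ, (a.map fun x => poch x k).prod /
      ((b.map fun x => poch x k).prod * k.factorial) * z ^ k := by
    simp only [hyperF, poch_one]
  rw [he]
  exact hs.hasSum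

theorem hasSum_of_hasSum_shift {f : ℕ → ℂ} {S : ℂ} (N : ℕ) (h0 : ∀ k < N, f k = 0)
    (h : HasSum (fun j => f (j + N)) S) : HasSum f S := by
  rw [hasSum_nat_add_iff] at h
  rwa [Finset.sum_eq_zero fun k hk => h0 k (Finset.mem_range.1 hk), add_zero] at h

theorem hasSum_of_hasSum_parity {f : ℕ → ℂ} {S : ℂ} {ε : ℕ} (h0 : ∀ k, Odd (k + ε) → f k = 0)
    (hε : ε = 0 ∨ ε = 1) (h : HasSum f S) : HasSum (fun k => f (2 * k + ε)) S := by
  have hinj : Function.Injective fun k : ℕ => 2 * k + ε := fun i j h => by simpa using h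
  refine (hinj.hasSum_iff (f := f) fun k hk => h0 k ?_).2 h
  by_contra hodd
  rw [Nat.not_odd_iff_even] at hodd
  obtain ⟨r, hr⟩ := hodd
  exact hk ⟨r - ε, by rcases hε with rfl | rfl <;> simp <;> omega⟩

/-! ### Fourier transforms -/

/-- On the compact interval the exponential series is dominated by a summable constant series, so it
may be integrated term by term. The function `h` is `t` for functions with parity and `(1 + t) / 2`
for the ramps. -/
theorem hasSum_integral_exp (z : ℂ) {h g : ℝ → ℝ} (hh : Continuous h) (hg : Continuous g) :
    HasSum (fun k : ℕ => z ^ k / k.factorial * ((∫ t in (-1 : ℝ)..1, h t ^ k * g t : ℝ) : ℂ))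
      (∫ t in (-1 : ℝ)..1, cexp (z * h t) * (g t : ℂ)) := by
  obtain ⟨C, hC⟩ := isCompact_Icc.exists_bound_of_continuousOn
    (hh.continuousOn (s := Icc (-1 : ℝ) 1))
  obtain ⟨D, hD⟩ := isCompact_Icc.exists_bound_of_continuousOn
    (hg.continuousOn (s := Icc (-1 : ℝ) 1))
  have hC0 : 0 ≤ C := (norm_nonneg _).trans (hC 0 (by norm_num))
  have key := intervalIntegral.hasSum_integral_of_dominated_convergence (a := (-1 : ℝ)) (b := 1)
    (μ := volume)
    (F := fun (k : ℕ) (t : ℝ) => z ^ k / k.factorial * ((h t ^ k * g t : ℝ) : ℂ))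
    (f := fun t => cexp (z * h t) * (g t : ℂ))
    (fun k _ => (‖z‖ * C) ^ k / k.factorial * D) ?_ ?_ ?_ ?_ ?_
  · have e : ∀ k : ℕ, ∫ t in (-1 : ℝ)..1, z ^ k / k.factorial * ((h t ^ k * g t : ℝ) : ℂ) =
        z ^ k / k.factorial * ((∫ t in (-1 : ℝ)..1, h t ^ k * g t : ℝ) : ℂ) := fun k => by
      rw [intervalIntegral.integral_const_mul, intervalIntegral.integral_ofReal]
    simpa only [e] using key
  · intro k
    exact Continuous.aestronglyMeasurable (by fun_prop)
  · intro k
    refine Filter.Eventually.of_forall fun t ht => ?_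
    rw [uIoc_of_le (by norm_num)] at ht
    have h1 := hC t ⟨ht.1.le, ht.2⟩
    have h2 := hD t ⟨ht.1.le, ht.2⟩
    rw [norm_mul, norm_div, norm_pow, Complex.norm_natCast, Complex.norm_real, norm_mul, norm_pow,
      mul_pow, mul_div_right_comm, mul_assoc]
    gcongr
  · exact Filter.Eventually.of_forall fun t _ =>
      (Real.summable_pow_div_factorial (‖z‖ * C)).mul_right D
  · exact intervalIntegrable_const
  · refine Filter.Eventually.of_forall fun t _ => ?_
    have h1 : HasSum (fun k : ℕ => (z * h t) ^ k / k.factorial) (cexp (z * h t)) := by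
      rw [Complex.exp_eq_exp_ℂ]
      exact NormedSpace.expSeries_div_hasSum_exp _
    have h2 := h1.mul_right (g t : ℂ)
    have e : ∀ k : ℕ, (z * h t) ^ k / k.factorial * (g t : ℂ) =
        z ^ k / k.factorial * ((h t ^ k * g t : ℝ) : ℂ) := fun k => by
      push_cast
      ring
    simpa only [e] using h2

theorem fourierT_of_ae_eq {f g : ℝ → ℝ} (h : f =ᵐ[volume] (Icc (-1 : ℝ) 1).indicator g) (w : ℝ) :
    fourierT f w = ∫ t in (-1 : ℝ)..1, cexp (-I * w * t) * (g t : ℂ) := by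
  rw [intervalIntegral.integral_of_le (by norm_num), ← integral_Icc_eq_integral_Ioc,
    ← integral_indicator measurableSet_Icc, fourierT]
  refine integral_congr_ae ?_
  filter_upwards [h] with t ht
  rw [ht]
  by_cases hm : t ∈ Icc (-1 : ℝ) 1 <;> simp [hm]

/-- The Fourier transform of a function of parity `ε`, as a power series. -/
theorem hasSum_fourierT_of_parity {f g : ℝ → ℝ} {ε : ℕ} (hε : ε = 0 ∨ ε = 1)
    (hg : Continuous g) (h : f =ᵐ[volume] (Icc (-1 : ℝ) 1).indicator g)
    (h0 : ∀ k, Odd (k + ε) → ∫ t in (-1 : ℝ)..1, t ^ k * g t = 0) (w : ℝ) :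
    HasSum (fun k : ℕ => (-I * w) ^ (2 * k + ε) / (2 * k + ε).factorial *
      ((∫ t in (-1 : ℝ)..1, t ^ (2 * k + ε) * g t : ℝ) : ℂ)) (fourierT f w) := by
  rw [fourierT_of_ae_eq h]
  refine hasSum_of_hasSum_parity (f := fun k : ℕ => (-I * w) ^ k / k.factorial *
      ((∫ t in (-1 : ℝ)..1, t ^ k * g t : ℝ) : ℂ)) (fun k hk => by simp [h0 k hk]) hε ?_
  exact hasSum_integral_exp (-I * w) continuous_id hg

/-! ### The orthogonal projection -/

theorem inner_cutL2 {f g : ℝ → ℝ} (hf : Continuous f) (hg : Continuous g) :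
    inner ℝ (cutL2 f hf) (cutL2 g hg) = ∫ t in (-1 : ℝ)..1, f t * g t := by
  rw [intervalIntegral.integral_of_le (by norm_num), ← integral_Icc_eq_integral_Ioc,
    ← integral_indicator measurableSet_Icc, L2.inner_def]
  refine integral_congr_ae ?_
  filter_upwards [(memLp_indicator hf).coeFn_toLp, (memLp_indicator hg).coeFn_toLp] with t h1 h2
  rw [cutL2, cutL2, h1, h2]
  by_cases hm : t ∈ Icc (-1 : ℝ) 1 <;> simp [hm, mul_comm]

/-- A splitting into an element of `A^n` and a function orthogonal to `A^n` is unique, so the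
projection never has to be computed: it suffices to exhibit `g`. -/
theorem subProj_cutL2 {n : ℕ} {f g : ℝ → ℝ} (hf : Continuous f) (hg : Continuous g)
    {p : Polynomial ℝ} (hp : p ∈ bubblePoly n) (hfg : ∀ t, f t = p.eval t + g t)
    (h : ∀ q ∈ bubblePoly n, ∫ t in (-1 : ℝ)..1, g t * q.eval t = 0) :
    subProj n (cutL2 f hf) = cutL2 g hg := by
  have hsum : cutL2 f hf = polyL2 p + cutL2 g hg := by
    change _ = cutL2 (fun t => p.eval t) p.continuous + _
    rw [cutL2, cutL2, cutL2, ← MemLp.toLp_add]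
    congr 1
    ext t
    by_cases hm : t ∈ Icc (-1 : ℝ) 1 <;> simp [hm, hfg]
  have hproj : (bubbleSpace n).starProjection (cutL2 f hf) = polyL2 p := by
    refine Submodule.eq_starProjection_of_mem_of_inner_eq_zero ⟨p, hp, rfl⟩ ?_
    rintro _ ⟨q, hq, rfl⟩
    rw [hsum, add_sub_cancel_left]
    exact (inner_cutL2 hg q.continuous).trans (h q hq)
  rw [subProj, hproj, hsum, add_sub_cancel_left]

theorem cutL2_ae_eq {f : ℝ → ℝ} (hf : Continuous f) :
    cutL2 f hf =ᵐ[volume] (Icc (-1 : ℝ) 1).indicator f :=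
  (memLp_indicator hf).coeFn_toLp

/-! ### Moments -/

theorem integral_pow_of_odd {k : ℕ} (hk : Odd k) : ∫ t in (-1 : ℝ)..1, t ^ k = 0 := by
  rw [integral_pow, hk.add_one.neg_one_pow]
  simp

theorem integral_pow_two_mul (l : ℕ) : ∫ t in (-1 : ℝ)..1, t ^ (2 * l) = 1 / (l + 1 / 2) := by
  rw [integral_pow, (odd_two_mul_add_one l).neg_one_pow]
  push_cast
  field_simp
  norm_num

theorem integral_abs_mul_pow (k : ℕ) :
    ∫ t in (-1 : ℝ)..1, |t| * t ^ k = (1 + (-1) ^ k) / (k + 2) := by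
  have hc : Continuous fun t : ℝ => |t| * t ^ k := by fun_prop
  rw [← intervalIntegral.integral_add_adjacent_intervals (hc.intervalIntegrable (-1) 0)
    (hc.intervalIntegrable 0 1)]
  have h1 : ∫ t in (-1 : ℝ)..0, |t| * t ^ k = ∫ t in (-1 : ℝ)..0, -t ^ (k + 1) := by
    refine intervalIntegral.integral_congr fun t ht => ?_
    rw [uIcc_of_le (by norm_num)] at ht
    simp only [abs_of_nonpos ht.2]
    ring
  have h2 : ∫ t in (0 : ℝ)..1, |t| * t ^ k = ∫ t in (0 : ℝ)..1, t ^ (k + 1) := by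
    refine intervalIntegral.integral_congr fun t ht => ?_
    rw [uIcc_of_le (by norm_num)] at ht
    simp only [abs_of_nonneg ht.1]
    ring
  rw [h1, h2, intervalIntegral.integral_neg, integral_pow, integral_pow]
  push_cast
  field_simp
  ring

/-- A function on the line of parity `ε` which is a polynomial plus a multiple of
`|t| t ^ (2 * m + ε)`. -/
def parityFun (s : Finset ℕ) (d : ℕ → ℝ) (D : ℝ) (m ε : ℕ) (t : ℝ) : ℝ :=
  ∑ j ∈ s, d j * t ^ (2 * j + ε) - D * (|t| * t ^ (2 * m + ε))

theorem continuous_parityFun (s : Finset ℕ) (d : ℕ → ℝ) (D : ℝ) (m ε : ℕ) :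
    Continuous (parityFun s d D m ε) := by
  unfold parityFun
  fun_prop

theorem integral_pow_mul_parityFun (s : Finset ℕ) (d : ℕ → ℝ) (D : ℝ) (m ε k : ℕ) :
    ∫ t in (-1 : ℝ)..1, t ^ k * parityFun s d D m ε t =
      (∑ j ∈ s, d j * ∫ t in (-1 : ℝ)..1, t ^ (k + 2 * j + ε)) -
        D * ∫ t in (-1 : ℝ)..1, |t| * t ^ (k + 2 * m + ε) := by
  have h : ∀ t : ℝ, t ^ k * parityFun s d D m ε t =
      ∑ j ∈ s, d j * t ^ (k + 2 * j + ε) - D * (|t| * t ^ (k + 2 * m + ε)) := fun t => by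
    rw [parityFun, mul_sub, Finset.mul_sum]
    congr 1
    · exact Finset.sum_congr rfl fun j _ => by ring
    · ring
  simp only [h]
  rw [intervalIntegral.integral_sub, intervalIntegral.integral_finsetSum,
    intervalIntegral.integral_const_mul]
  · simp only [intervalIntegral.integral_const_mul]
  · exact fun j _ => Continuous.intervalIntegrable (by fun_prop) _ _
  · exact Continuous.intervalIntegrable (by fun_prop) _ _
  · exact Continuous.intervalIntegrable (by fun_prop) _ _

theorem integral_pow_mul_parityFun_of_odd (s : Finset ℕ) (d : ℕ → ℝ) (D : ℝ) (m : ℕ) {ε k : ℕ}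
    (hk : Odd (k + ε)) : ∫ t in (-1 : ℝ)..1, t ^ k * parityFun s d D m ε t = 0 := by
  have h : ∀ j, Odd (k + 2 * j + ε) := fun j => by
    rw [add_right_comm]
    exact hk.add_even (even_two_mul j)
  rw [integral_pow_mul_parityFun, integral_abs_mul_pow, (h m).neg_one_pow,
    Finset.sum_eq_zero fun j _ => by rw [integral_pow_of_odd (h j), mul_zero]]
  simp

/-- The power `t ^ (2 * j + ε)` produces the pole `-(j + ε + 1/2)` and the term with `|t|` the pole
`-(m + ε + 1)`; prescribing the moments is thus a partial fraction problem. -/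
theorem integral_pow_mul_parityFun_of_even (s : Finset ℕ) (d : ℕ → ℝ) (D : ℝ) (m ε k : ℕ) :
    ∫ t in (-1 : ℝ)..1, t ^ (2 * k + ε) * parityFun s d D m ε t =
      ∑ j ∈ s, d j / (k + (j + ε + 1 / 2)) - D / (k + (m + ε + 1)) := by
  have h : ∀ j, 2 * k + ε + 2 * j + ε = 2 * (k + j + ε) := fun j => by ring
  rw [integral_pow_mul_parityFun, integral_abs_mul_pow]
  simp only [h]
  rw [(even_two_mul _).neg_one_pow]
  congr 1
  · refine Finset.sum_congr rfl fun j _ => ?_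
    rw [integral_pow_two_mul]
    push_cast
    rw [mul_one_div]
    ring_nf
  · push_cast
    field_simp
    ring

/-- A function of parity `ε` with constant moments up to a certain order is orthogonal to the
polynomials of at most that degree vanishing at `±1`. -/
theorem integral_mul_eq_zero_of_mem_bubblePoly {n ε : ℕ} (hε : ε = 0 ∨ ε = 1) {g : ℝ → ℝ}
    (hg : Continuous g) {K : ℝ}
    (h0 : ∀ k, Odd (k + ε) → ∫ t in (-1 : ℝ)..1, t ^ k * g t = 0)
    (h1 : ∀ k ≤ n, ∫ t in (-1 : ℝ)..1, t ^ (2 * k + ε) * g t = K)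
    {q : Polynomial ℝ} (hq : q ∈ bubblePoly (2 * n + 1 + ε)) :
    ∫ t in (-1 : ℝ)..1, g t * q.eval t = 0 := by
  have hdeg : q.natDegree < 2 * n + 1 + ε + 1 :=
    Nat.lt_succ_of_le (Polynomial.natDegree_le_of_degree_le (Polynomial.mem_degreeLE.1 hq.1.1))
  have hm : q.eval (-1) = 0 := hq.1.2
  have hp : q.eval 1 = 0 := hq.2
  have h2 : ∀ t : ℝ, g t * q.eval t =
      ∑ i ∈ Finset.range (2 * n + 1 + ε + 1), q.coeff i * (t ^ i * g t) := fun t => by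
    rw [Polynomial.eval_eq_sum_range' hdeg, Finset.mul_sum]
    exact Finset.sum_congr rfl fun i _ => by ring
  -- Averaging `1 ^ i` with `(-1) ^ (i + ε)` selects the exponents of parity `ε`. The sum over `i`
  -- then becomes a combination of `q(1)` and `q(-1)`, both zero.
  have h3 : ∀ i ∈ Finset.range (2 * n + 1 + ε + 1),
      q.coeff i * ∫ t in (-1 : ℝ)..1, t ^ i * g t =
        K / 2 * (q.coeff i * 1 ^ i) + K / 2 * (-1) ^ ε * (q.coeff i * (-1) ^ i) := by
    intro i hi
    rw [Finset.mem_range] at hi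
    rcases Nat.even_or_odd (i + ε) with he | ho
    · have h4 : (-1 : ℝ) ^ ε * (-1) ^ i = 1 := by rw [← pow_add, add_comm, he.neg_one_pow]
      obtain ⟨k, rfl⟩ : ∃ k, i = 2 * k + ε := by
        obtain ⟨r, hr⟩ := he
        exact ⟨r - ε, by omega⟩
      rw [h1 k (by omega), one_pow]
      linear_combination (-(K / 2 * q.coeff (2 * k + ε))) * h4
    · have h4 : (-1 : ℝ) ^ ε * (-1) ^ i = -1 := by rw [← pow_add, add_comm, ho.neg_one_pow]
      rw [h0 i ho, one_pow]
      linear_combination (-(K / 2 * q.coeff i)) * h4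
  simp only [h2]
  rw [intervalIntegral.integral_finsetSum
    fun i _ => Continuous.intervalIntegrable (by fun_prop) _ _]
  simp only [intervalIntegral.integral_const_mul]
  rw [Finset.sum_congr rfl h3, Finset.sum_add_distrib, ← Finset.mul_sum, ← Finset.mul_sum,
    ← Polynomial.eval_eq_sum_range' hdeg, ← Polynomial.eval_eq_sum_range' hdeg, hm, hp]
  simp

/-! ### Identities for products and factorials -/

theorem sum_range_cast (n : ℕ) : ∑ j ∈ Finset.range n, (j : ℝ) = n * (n - 1) / 2 := by
  induction n with
  | zero => simp
  | succ n ih =>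
    rw [Finset.sum_range_succ, ih]
    push_cast
    ring

theorem prod_range_sub_cast (n : ℕ) :
    ∏ i ∈ Finset.range n, ((i : ℝ) - n) = (-1) ^ n * n.factorial := by
  have h : ∏ i ∈ Finset.range n, ((i : ℝ) - n) = ∏ i ∈ Finset.range n, (-1 * ((i : ℝ) + 1)) := by
    rw [← Finset.prod_range_reflect]
    refine Finset.prod_congr rfl fun i hi => ?_
    have hi' := Finset.mem_range.1 hi
    rw [Nat.sub_sub, Nat.cast_sub (by omega)]
    push_cast
    ring
  rw [h, Finset.prod_mul_distrib, ← Finset.prod_range_add_one_eq_factorial,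
    Finset.prod_const, Finset.card_range]
  push_cast
  rfl

theorem prod_range_neg_sub (x : ℝ) (n : ℕ) :
    ∏ i ∈ Finset.range n, (-x - i) = (-1) ^ n * ∏ i ∈ Finset.range n, (x + i) := by
  have h : ∏ i ∈ Finset.range n, (-x - i) = ∏ i ∈ Finset.range n, (-1 * (x + i)) :=
    Finset.prod_congr rfl fun i _ => by ring
  rw [h, Finset.prod_mul_distrib]
  simp

theorem prod_range_cast_sub_eq_zero {k n : ℕ} (h : k < n) :
    ∏ i ∈ Finset.range n, ((k : ℝ) - i) = 0 :=
  Finset.prod_eq_zero (Finset.mem_range.2 h) (sub_self _)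

theorem prod_range_cast_sub_mul_factorial (j n : ℕ) :
    (∏ i ∈ Finset.range n, (((j + n : ℕ) : ℝ) - i)) * j.factorial = (j + n).factorial := by
  induction n with
  | zero => simp
  | succ n ih =>
    rw [Finset.prod_range_succ']
    have h : ∏ i ∈ Finset.range n, (((j + (n + 1) : ℕ) : ℝ) - ((i + 1 : ℕ) : ℝ)) =
        ∏ i ∈ Finset.range n, (((j + n : ℕ) : ℝ) - i) :=
      Finset.prod_congr rfl fun i _ => by push_cast; ring
    rw [h, ← add_assoc, Nat.factorial_succ, Nat.cast_mul, ← ih]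
    push_cast
    ring

/-- The duplication formula splits the factorial of the exponential series into the `k!` and the
half-integer Pochhammer symbol of a `₀F₁`. -/
theorem factorial_two_mul_add (k : ℕ) {ε : ℕ} (hε : ε = 0 ∨ ε = 1) :
    ((2 * k + ε).factorial : ℂ) = 2 ^ (2 * k + ε) * k.factorial * poch (1 / 2) (k + ε) := by
  have h0 : ∀ k : ℕ, ((2 * k).factorial : ℂ) = 2 ^ (2 * k) * k.factorial * poch (1 / 2) k := by
    intro k
    induction k with
    | zero => simp [poch]
    | succ k ih =>
      rw [mul_add, mul_one, Nat.factorial_succ, Nat.factorial_succ, Nat.factorial_succ, poch_succ]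
      push_cast
      rw [ih]
      ring
  rcases hε with rfl | rfl
  · exact h0 k
  · rw [Nat.factorial_succ, poch_succ]
    push_cast
    rw [h0]
    ring

/-! ### The bubble functions -/

theorem jacobiWeight_two (x : ℝ) : jacobiWeight (5 / 2 - 1 / 2) (5 / 2 - 1 / 2) x =
    (1 - x ^ 2) * (1 - x ^ 2) := by
  have h : (5 / 2 - 1 / 2 : ℝ) = (2 : ℕ) := by norm_num
  rw [jacobiWeight, h, Real.rpow_natCast, Real.rpow_natCast]
  ring

/-- An even or odd polynomial with the right zeros, leading coefficient and moments is a bubble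
function. -/
theorem bubble_eq_indicator_parityFun {n ε : ℕ} (hn : 1 ≤ n) (hε : ε = 0 ∨ ε = 1) {d : ℕ → ℝ}
    (hlead : d n = -1) (hsum : ∑ j ∈ Finset.range (n + 1), d j = 0) {K : ℝ}
    (hK : ∀ k < n, ∫ t in (-1 : ℝ)..1,
      t ^ (2 * k + ε) * parityFun (Finset.range (n + 1)) d 0 0 ε t = K) :
    bubble (2 * n + ε) =
      (Icc (-1 : ℝ) 1).indicator (parityFun (Finset.range (n + 1)) d 0 0 ε) := by
  set g := parityFun (Finset.range (n + 1)) d 0 0 ε with hg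
  have hgc : Continuous g := continuous_parityFun _ _ _ _ _
  set p : Polynomial ℝ := Polynomial.X ^ (2 * n + ε) +
    ∑ j ∈ Finset.range n, Polynomial.C (-d j) * Polynomial.X ^ (2 * j + ε) with hp
  have hpe : ∀ t, g t = -p.eval t := fun t => by
    rw [hg, parityFun, hp, Finset.sum_range_succ, hlead]
    simp [Polynomial.eval_finsetSum]
  have hlow : (∑ j ∈ Finset.range n,
      Polynomial.C (-d j) * Polynomial.X ^ (2 * j + ε)).degree < ((2 * n + ε : ℕ) : WithBot ℕ) := by
    rw [← Polynomial.mem_degreeLT]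
    refine Submodule.sum_mem _ fun j hj => ?_
    rw [Polynomial.mem_degreeLT]
    refine (Polynomial.degree_C_mul_X_pow_le _ _).trans_lt ?_
    have := Finset.mem_range.1 hj
    exact_mod_cast (by omega : 2 * j + ε < 2 * n + ε)
  have hpm : p.Monic := Polynomial.monic_X_pow_add hlow
  have hpd : p.natDegree = 2 * n + ε := by
    refine Polynomial.natDegree_eq_of_degree_eq_some ?_
    rw [hp, Polynomial.degree_add_eq_left_of_degree_lt (by rwa [Polynomial.degree_X_pow]),
      Polynomial.degree_X_pow]
  have hsum' : ∑ j ∈ Finset.range n, d j = 1 := by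
    rw [Finset.sum_range_succ, hlead] at hsum
    linarith
  have hroot1 : p.IsRoot 1 := by
    rw [Polynomial.IsRoot, hp]
    simp [Polynomial.eval_finsetSum, hsum']
  have hroot2 : p.IsRoot (-1) := by
    rw [Polynomial.IsRoot, hp]
    simp [Polynomial.eval_finsetSum, pow_add, pow_mul, ← Finset.sum_mul, hsum']
  obtain ⟨q, hq⟩ : (Polynomial.X ^ 2 - 1 : Polynomial ℝ) ∣ p := by
    have hcop : IsCoprime (Polynomial.X - Polynomial.C (1 : ℝ)) (Polynomial.X - Polynomial.C (-1)) :=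
      Polynomial.isCoprime_X_sub_C_of_isUnit_sub (by norm_num)
    have h := hcop.mul_dvd (Polynomial.dvd_iff_isRoot.2 hroot1) (Polynomial.dvd_iff_isRoot.2 hroot2)
    convert h using 1
    simp only [map_neg, map_one]
    ring
  have hXm : (Polynomial.X ^ 2 - 1 : Polynomial ℝ).Monic :=
    Polynomial.monic_X_pow_sub_C 1 two_ne_zero
  have hXd : (Polynomial.X ^ 2 - 1 : Polynomial ℝ).natDegree = 2 :=
    Polynomial.natDegree_X_pow_sub_C (n := 2) (r := (1 : ℝ))
  have hqm : q.Monic := hXm.of_mul_monic_left (hq ▸ hpm)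
  have hqd : q.natDegree = 2 * n + ε - 2 := by
    rw [hq, hXm.natDegree_mul hqm, hXd] at hpd
    omega
  have hgq : ∀ t, g t = (1 - t ^ 2) * q.eval t := fun t => by
    rw [hpe, hq]
    simp
    ring
  have hJ : IsMonicJacobi (5 / 2 - 1 / 2) (5 / 2 - 1 / 2) (2 * n + ε - 2) q := by
    refine ⟨hqm, hqd, fun i hi => ?_⟩
    -- One factor `1 - t²` of the weight turns `q` into `g`; the other takes the difference of two
    -- successive moments of `g`. Since `i < 2n + ε - 2`, both lie in the range where the moments
    -- equal `K`.
    have h1 : ∀ t : ℝ, q.eval t * t ^ i * jacobiWeight (5 / 2 - 1 / 2) (5 / 2 - 1 / 2) t =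
        t ^ i * g t - t ^ (i + 2) * g t := fun t => by
      rw [jacobiWeight_two, hgq]
      ring
    simp only [h1]
    rw [intervalIntegral.integral_sub (Continuous.intervalIntegrable (by fun_prop) _ _)
      (Continuous.intervalIntegrable (by fun_prop) _ _)]
    rcases Nat.even_or_odd (i + ε) with he | ho
    · obtain ⟨k, rfl⟩ : ∃ k, i = 2 * k + ε := by
        obtain ⟨r, hr⟩ := he
        exact ⟨r - ε, by omega⟩
      have h2 : 2 * k + ε + 2 = 2 * (k + 1) + ε := by ring
      rw [h2, hK k (by omega), hK (k + 1) (by omega), sub_self]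
    · rw [hg, integral_pow_mul_parityFun_of_odd _ _ _ _ ho,
        integral_pow_mul_parityFun_of_odd _ _ _ _ (by
          rw [add_right_comm]
          exact ho.add_even even_two), sub_self]
  have hu : ultraspherical (5 / 2) (2 * n + ε - 2) = q :=
    (existsUnique_isMonicJacobi (by norm_num) (by norm_num) _).unique
      (isMonicJacobi_monicJacobi (by norm_num) (by norm_num) _) hJ
  rw [bubble, if_pos (by omega), hu]
  congr 1
  ext t
  rw [hgq]

theorem injOn_add_half (ε : ℕ) (s : Set ℕ) : Set.InjOn (fun j : ℕ => (j : ℝ) + ε + 1 / 2) s :=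
  fun i _ j _ h => by simpa using h

/-- The bubble functions are polynomials of parity `ε` with explicit moments. -/
theorem exists_bubble_eq {n ε : ℕ} (hn : 1 ≤ n) (hε : ε = 0 ∨ ε = 1) :
    ∃ d : ℕ → ℝ, bubble (2 * n + ε) =
        (Icc (-1 : ℝ) 1).indicator (parityFun (Finset.range (n + 1)) d 0 0 ε) ∧
      ∀ k : ℕ, ∫ t in (-1 : ℝ)..1,
          t ^ (2 * k + ε) * parityFun (Finset.range (n + 1)) d 0 0 ε t =
        (n - 1).factorial / (∏ i ∈ Finset.range (n + 1), ((n : ℝ) - 1 / 2 + ε + i)) *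
          (1 - (∏ i ∈ Finset.range n, ((k : ℝ) - i)) * (k - n + (n + 1) * (n + 1 / 2 + ε)) /
            ∏ i ∈ Finset.range (n + 1), ((k : ℝ) + ε + 1 / 2 + i)) := by
  set K : ℝ := (n - 1).factorial / ∏ i ∈ Finset.range (n + 1), ((n : ℝ) - 1 / 2 + ε + i) with hK
  -- The last zero `β` solves `∑ (a j + b j) = 0`, so the residues sum to zero and the function
  -- vanishes at `±1`. The constant `K` is then forced by the leading coefficient `-1`.
  set β : ℝ := n - (n + 1) * (n + 1 / 2 + ε) with hβ
  have hnR : (1 : ℝ) ≤ n := by exact_mod_cast hn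
  have hpos : ∏ i ∈ Finset.range (n + 1), ((n : ℝ) - 1 / 2 + ε + i) ≠ 0 := by
    refine (Finset.prod_pos fun i _ => ?_).ne'
    have h1 : (0 : ℝ) ≤ ε := Nat.cast_nonneg _
    have h2 : (0 : ℝ) ≤ i := Nat.cast_nonneg _
    linarith
  set b : ℕ → ℝ := fun j => if j < n then j else β with hb
  have hbn : b n = β := by simp [hb]
  have hbj : ∀ j ∈ Finset.range n, b j = j := fun j hj => by simp [hb, Finset.mem_range.1 hj]
  have hprod : ∀ x : ℝ, ∏ j ∈ Finset.range (n + 1), (x - b j) =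
      (∏ j ∈ Finset.range n, (x - j)) * (x - β) := fun x => by
    rw [Finset.prod_range_succ, hbn]
    congr 1
    exact Finset.prod_congr rfl fun j hj => by rw [hbj j hj]
  obtain ⟨c, hc1, hc2, hc3⟩ := exists_partialFraction (Finset.range (n + 1))
    (fun j => (j : ℝ) + ε + 1 / 2) b (injOn_add_half ε _)
  have hmom : ∀ k : ℕ, ∫ t in (-1 : ℝ)..1,
        t ^ (2 * k + ε) * parityFun (Finset.range (n + 1)) (fun j => K * c j) 0 0 ε t =
      K * (1 - (∏ i ∈ Finset.range n, ((k : ℝ) - i)) * (k - n + (n + 1) * (n + 1 / 2 + ε)) /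
          ∏ i ∈ Finset.range (n + 1), ((k : ℝ) + ε + 1 / 2 + i)) := by
    intro k
    have h1 := hc1 k fun j _ => by positivity
    have h2 : ∏ j ∈ Finset.range (n + 1), ((k : ℝ) + (j + ε + 1 / 2)) =
        ∏ i ∈ Finset.range (n + 1), ((k : ℝ) + ε + 1 / 2 + i) :=
      Finset.prod_congr rfl fun i _ => by ring
    have h3 : (k : ℝ) - β = k - n + (n + 1) * (n + 1 / 2 + ε) := by rw [hβ]; ring
    rw [hprod, h2, h3] at h1
    rw [integral_pow_mul_parityFun_of_even, ← h1, Finset.mul_sum, zero_div, sub_zero]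
    exact Finset.sum_congr rfl fun j _ => mul_div_assoc _ _ _
  have hsum : ∑ j ∈ Finset.range (n + 1), c j = 0 := by
    rw [hc2, Finset.sum_add_distrib, Finset.sum_range_succ b, hbn, Finset.sum_congr rfl hbj,
      Finset.sum_add_distrib, Finset.sum_add_distrib, sum_range_cast, sum_range_cast]
    simp only [Finset.sum_const, Finset.card_range, nsmul_eq_mul, hβ]
    push_cast
    ring
  -- In the residue at the last pole, the zero `β` contributes `-a n - β = n (n - 1/2 + ε)`: the
  -- factor `n` cancels against `n! = n (n - 1)!`, and the other one completes the product in `K`.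
  have hlead : K * c n = -1 := by
    have h1 := hc3 n (Finset.self_mem_range_succ n)
    have h2 : ∏ i ∈ (Finset.range (n + 1)).erase n, ((i : ℝ) + ε + 1 / 2 - (n + ε + 1 / 2)) =
        (-1) ^ n * n.factorial := by
      rw [← prod_range_sub_cast, Finset.range_add_one, Finset.erase_insert Finset.notMem_range_self]
      exact Finset.prod_congr rfl fun i _ => by ring
    have h3 : ∏ i ∈ Finset.range (n + 1), ((n : ℝ) - 1 / 2 + ε + i) =
        (∏ i ∈ Finset.range n, ((n : ℝ) + ε + 1 / 2 + i)) * (n - 1 / 2 + ε) := by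
      rw [Finset.prod_range_succ']
      push_cast
      rw [add_zero]
      congr 1
      exact Finset.prod_congr rfl fun i _ => by ring
    have h4 : (n.factorial : ℝ) = n * (n - 1).factorial := by
      exact_mod_cast (Nat.mul_factorial_pred (by omega)).symm
    have h5 : ((-1 : ℝ) ^ n) * (-1) ^ n = 1 := by rw [← pow_add, (Even.add_self n).neg_one_pow]
    rw [h2, hprod, prod_range_neg_sub, hβ, h4] at h1
    rw [hK, div_mul_eq_mul_div, div_eq_iff hpos, h3]
    refine mul_left_cancel₀ (by positivity : (n : ℝ) ≠ 0) ?_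
    linear_combination (-1 : ℝ) ^ n * h1 - (c n * (n * (n - 1).factorial) +
      (∏ i ∈ Finset.range n, ((n : ℝ) + ε + 1 / 2 + i)) *
        (-(n + ε + 1 / 2) - (n - (n + 1) * (n + 1 / 2 + ε)))) * h5
  refine ⟨fun j => K * c j, bubble_eq_indicator_parityFun hn hε hlead ?_ (K := K) ?_, hmom⟩
  · rw [← Finset.mul_sum, hsum, mul_zero]
  · intro k hk
    rw [hmom, prod_range_cast_sub_eq_zero hk]
    simp

/-! ### The Fourier transform of the bubble functions -/

theorem hasSum_hyperF_zero_one {b : ℝ} (hb : 1 / 2 ≤ b) (z : ℂ) :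
    HasSum (fun k : ℕ => 1 / (poch b k * k.factorial) * z ^ k) (hyperF [] [(b : ℂ)] z) := by
  have h := hasSum_hyperF [] [(b : ℂ)] z 2 fun i => ?_
  · simpa using h
  · have h1 : ‖(b : ℂ) + i‖ = b + i := by
      rw [← Complex.ofReal_natCast, ← Complex.ofReal_add, Complex.norm_real, Real.norm_of_nonneg]
      positivity
    have h2 : (0 : ℝ) ≤ i := Nat.cast_nonneg i
    simp only [List.map_nil, List.prod_nil, List.map_cons, List.prod_cons, mul_one, h1]
    linarith

theorem poch_half_ne_zero (a k : ℕ) : poch ((a : ℂ) + 1 / 2) k ≠ 0 := by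
  have := poch_ne_zero (a := (a : ℝ) + 1 / 2) (by positivity) k
  push_cast at this
  exact this

/-- The terms of the power series of the Fourier transform, compared with those of `₀F₁`. -/
theorem fourier_coeff_eq (N n j : ℕ) {ε : ℕ} (hε : ε = 0 ∨ ε = 1) (w : ℂ) :
    (-I * w) ^ (2 * (j + N) + ε) / (2 * (j + N) + ε).factorial *
        ((∏ i ∈ Finset.range N, (((j + N : ℕ) : ℂ) - i)) /
          poch (((j + N : ℕ) : ℂ) + ε + 1 / 2) (n + 1)) =
      (-1) ^ N * (-I) ^ ε / poch (1 / 2) (N + n + 1 + ε) * (w / 2) ^ (2 * N + ε) *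
        (1 / (poch (((N + n + 1 + ε : ℕ) : ℂ) + 1 / 2) j * j.factorial) * (-(w / 2) ^ 2) ^ j) := by
  have h1 : (∏ i ∈ Finset.range N, (((j + N : ℕ) : ℂ) - i)) * (j.factorial : ℂ) =
      (j + N).factorial := by
    exact_mod_cast congrArg (fun x : ℝ => (x : ℂ)) (prod_range_cast_sub_mul_factorial j N)
  -- Both sides are the single symbol `(1/2)_{j + N + n + 1 + ε}`, cut at two different places.
  have h2 : poch (1 / 2) (j + N + ε) * poch (((j + N : ℕ) : ℂ) + ε + 1 / 2) (n + 1) =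
      poch (1 / 2) (N + n + 1 + ε) * poch (((N + n + 1 + ε : ℕ) : ℂ) + 1 / 2) j := by
    have e1 : ((j + N : ℕ) : ℂ) + ε + 1 / 2 = 1 / 2 + ((j + N + ε : ℕ) : ℂ) := by
      push_cast
      ring
    have e2 : j + N + ε + (n + 1) = N + n + 1 + ε + j := by ring
    rw [e1, ← poch_add, add_comm _ (1 / 2 : ℂ), ← poch_add, e2]
  have h3 : poch (1 / 2) (j + N + ε) ≠ 0 := by simpa using poch_half_ne_zero 0 (j + N + ε)
  have h4 : poch (((j + N : ℕ) : ℂ) + ε + 1 / 2) (n + 1) ≠ 0 := by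
    simpa using poch_half_ne_zero (j + N + ε) (n + 1)
  have h5 : poch (1 / 2) (N + n + 1 + ε) ≠ 0 := by simpa using poch_half_ne_zero 0 (N + n + 1 + ε)
  have h6 := poch_half_ne_zero (N + n + 1 + ε) j
  have h7 : (j.factorial : ℂ) ≠ 0 := by exact_mod_cast j.factorial_ne_zero
  have h8 : (∏ i ∈ Finset.range N, (((j + N : ℕ) : ℂ) - i)) / ((2 * (j + N) + ε).factorial *
        poch (((j + N : ℕ) : ℂ) + ε + 1 / 2) (n + 1)) =
      1 / (2 ^ (2 * (j + N) + ε) * (poch (1 / 2) (N + n + 1 + ε) *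
        poch (((N + n + 1 + ε : ℕ) : ℂ) + 1 / 2) j * j.factorial)) := by
    have h9 : ((j + N).factorial : ℂ) ≠ 0 := by exact_mod_cast (j + N).factorial_ne_zero
    rw [factorial_two_mul_add _ hε, div_eq_div_iff
      (mul_ne_zero (mul_ne_zero (mul_ne_zero (pow_ne_zero _ two_ne_zero) h9) h3) h4)
      (mul_ne_zero (pow_ne_zero _ two_ne_zero) (mul_ne_zero (mul_ne_zero h5 h6) h7)), ← h1]
    linear_combination (2 ^ (2 * (j + N) + ε) * j.factorial *
      ∏ i ∈ Finset.range N, (((j + N : ℕ) : ℂ) - i)) * -h2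
  have h10 : (-I * w) ^ (2 * (j + N) + ε) = (-1) ^ (j + N) * (-I) ^ ε * w ^ (2 * (j + N) + ε) := by
    rw [mul_pow, pow_add (-I), pow_mul, neg_sq, I_sq]
  calc _ = (-I * w) ^ (2 * (j + N) + ε) *
        ((∏ i ∈ Finset.range N, (((j + N : ℕ) : ℂ) - i)) / ((2 * (j + N) + ε).factorial *
          poch (((j + N : ℕ) : ℂ) + ε + 1 / 2) (n + 1))) := by ring
    _ = (-1) ^ (j + N) * (-I) ^ ε * (w / 2) ^ (2 * (j + N) + ε) / (poch (1 / 2) (N + n + 1 + ε) *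
        poch (((N + n + 1 + ε : ℕ) : ℂ) + 1 / 2) j * j.factorial) := by
      rw [h8, h10, div_pow]
      field_simp
    _ = _ := by
      rw [neg_pow ((w / 2) ^ 2), ← pow_mul]
      field_simp
      ring

/-- The product kills the terms with `k < N`; this is the source of the factor `(w / 2) ^ (2 * N +
ε)`. -/
theorem hasSum_fourier_remainder (N n : ℕ) {ε : ℕ} (hε : ε = 0 ∨ ε = 1) (w : ℂ) :
    HasSum (fun k : ℕ => (-I * w) ^ (2 * k + ε) / (2 * k + ε).factorial *
        ((∏ i ∈ Finset.range N, ((k : ℂ) - i)) / poch ((k : ℂ) + ε + 1 / 2) (n + 1)))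
      ((-1) ^ N * (-I) ^ ε / poch (1 / 2) (N + n + 1 + ε) * (w / 2) ^ (2 * N + ε) *
        hyperF [] [(((N + n + 1 + ε : ℕ) : ℝ) + 1 / 2 : ℝ)] (-(w / 2) ^ 2)) := by
  refine hasSum_of_hasSum_shift N (fun k hk => ?_) ?_
  · rw [Finset.prod_eq_zero (Finset.mem_range.2 hk) (sub_self _)]
    simp
  · simp only [fourier_coeff_eq _ _ _ hε]
    refine HasSum.mul_left _ ?_
    simpa using hasSum_hyperF_zero_one (b := ((N + n + 1 + ε : ℕ) : ℝ) + 1 / 2)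
      (by simp; positivity) (-(w / 2) ^ 2)

theorem hasSum_cos_sub {ε : ℕ} (hε : ε = 0 ∨ ε = 1) (w : ℂ) :
    HasSum (fun k : ℕ => (-I * w) ^ (2 * k + ε) / (2 * k + ε).factorial)
      ((-I) ^ ε * Complex.cos (w - ε * (Real.pi / 2))) := by
  have e : ∀ k : ℕ, (-I * w) ^ (2 * k + ε) / (2 * k + ε).factorial =
      (-I) ^ ε * ((-1) ^ k * w ^ (2 * k + ε) / (2 * k + ε).factorial) := fun k => by
    rw [mul_pow, pow_add (-I), pow_mul, neg_sq, I_sq]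
    ring
  simp only [e]
  refine HasSum.mul_left _ ?_
  rcases hε with rfl | rfl
  · simpa using Complex.hasSum_cos w
  · simpa [Complex.cos_sub_pi_div_two] using Complex.hasSum_sin w

theorem fourierT_bubble {n ε : ℕ} (w : ℝ) (hn : 1 ≤ n) (hε : ε = 0 ∨ ε = 1) :
    fourierT (bubble (2 * n + ε)) w =
      (-I) ^ ε * ((n - 1).factorial : ℂ) / poch (n - 1 / 2 + ε) (n + 1)
          * Complex.cos (w - ε * (Real.pi / 2))
        + (-1) ^ n * (-I) ^ ε * ((n - 1).factorial : ℂ)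
            / (poch (n - 1 / 2 + ε) (n + 1) * poch (1 / 2) (2 * n + 2 + ε))
            * ((w : ℂ) / 2) ^ (2 * n + 2 + ε)
            * hyperF [] [2 * n + 5 / 2 + ε] (-((w : ℂ) / 2) ^ 2)
        + (-1) ^ (n - 1) * (-I) ^ ε * ((n - 1).factorial : ℂ) * (n + 1) * (n + 1 / 2 + ε)
            / (poch (n - 1 / 2 + ε) (n + 1) * poch (1 / 2) (2 * n + 1 + ε))
            * ((w : ℂ) / 2) ^ (2 * n + ε)
            * hyperF [] [2 * n + 3 / 2 + ε] (-((w : ℂ) / 2) ^ 2) := by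
  obtain ⟨d, hd, hmom⟩ := exists_bubble_eq hn hε
  have hsum := hasSum_fourierT_of_parity hε (continuous_parityFun (Finset.range (n + 1)) d 0 0 ε)
    (Filter.EventuallyEq.of_eq hd)
    (fun k hk => integral_pow_mul_parityFun_of_odd _ _ _ _ hk) w
  simp only [hmom] at hsum
  refine hsum.unique ?_
  set P : ℂ := poch (n - 1 / 2 + ε) (n + 1) with hP
  -- The last factor of the numerator is split as `(k - n) + (n + 1)(n + 1/2 + ε)`. The first part
  -- lengthens the product to `n + 1` factors, the second leaves `n`, whence the two `₀F₁`.
  have key := (((hasSum_cos_sub hε w).mul_left (((n - 1).factorial : ℂ) / P)).sub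
    ((hasSum_fourier_remainder (n + 1) n hε w).mul_left (((n - 1).factorial : ℂ) / P))).sub
    ((hasSum_fourier_remainder n n hε w).mul_left
      (((n - 1).factorial : ℂ) / P * ((n + 1) * (n + 1 / 2 + ε))))
  have hP' : ((∏ i ∈ Finset.range (n + 1), ((n : ℝ) - 1 / 2 + ε + i) : ℝ) : ℂ) = P := by
    rw [hP, poch]
    push_cast
    rfl
  have hA : ∀ k : ℕ, ((∏ i ∈ Finset.range (n + 1), ((k : ℝ) + ε + 1 / 2 + i) : ℝ) : ℂ) =
      poch ((k : ℂ) + ε + 1 / 2) (n + 1) := fun k => by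
    rw [poch]
    push_cast
    rfl
  have hn1 : (-1 : ℂ) ^ n = -(-1) ^ (n - 1) := by
    obtain ⟨r, rfl⟩ : ∃ r, n = r + 1 := ⟨n - 1, by omega⟩
    simp [pow_succ]
  have e1 : ((((n + 1 + n + 1 + ε : ℕ) : ℝ) + 1 / 2 : ℝ) : ℂ) = 2 * n + 5 / 2 + ε := by
    push_cast
    ring
  have e2 : ((((n + n + 1 + ε : ℕ) : ℝ) + 1 / 2 : ℝ) : ℂ) = 2 * n + 3 / 2 + ε := by
    push_cast
    ring
  rw [e1, e2, (by ring : n + 1 + n + 1 + ε = 2 * n + 2 + ε), (by ring : n + n + 1 + ε = 2 * n + 1 + ε),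
    (by ring : 2 * (n + 1) + ε = 2 * n + 2 + ε)] at key
  convert! key using 1
  · funext k
    rw [Complex.ofReal_mul, Complex.ofReal_div, hP', Complex.ofReal_sub, Complex.ofReal_div, hA,
      Finset.prod_range_succ _ n]
    push_cast
    ring
  · rw [hn1, pow_succ (-1 : ℂ) n, hn1]
    ring

/-! ### The ramps -/

theorem integral_half_add_pow (m : ℕ) :
    ∫ t in (-1 : ℝ)..1, ((1 + t) / 2) ^ m = 2 / (m + 1) := by
  have h := intervalIntegral.integral_comp_add_div (a := (-1 : ℝ)) (b := 1) (c := 2)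
    (fun x : ℝ => x ^ m) two_ne_zero (1 / 2)
  have e : ∀ t : ℝ, (1 + t) / 2 = 1 / 2 + t / 2 := fun t => by ring
  simp only [e]
  rw [h, integral_pow]
  norm_num
  ring

/-- The polynomial `∑ j < n, d j * s ^ (j + 1)` in `s = (1 + t) / 2`. -/
noncomputable def rampFun (n : ℕ) (d : ℕ → ℝ) (t : ℝ) : ℝ :=
  ∑ j ∈ Finset.range n, d j * ((1 + t) / 2) ^ (j + 1)

theorem continuous_rampFun (n : ℕ) (d : ℕ → ℝ) : Continuous (rampFun n d) := by
  unfold rampFun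
  fun_prop

theorem integral_pow_mul_rampFun (n : ℕ) (d : ℕ → ℝ) (k : ℕ) :
    ∫ t in (-1 : ℝ)..1, ((1 + t) / 2) ^ k * rampFun n d t =
      ∑ j ∈ Finset.range n, 2 * d j / (k + (j + 2)) := by
  have h : ∀ t : ℝ, ((1 + t) / 2) ^ k * rampFun n d t =
      ∑ j ∈ Finset.range n, d j * ((1 + t) / 2) ^ (k + j + 1) := fun t => by
    rw [rampFun, Finset.mul_sum]
    exact Finset.sum_congr rfl fun j _ => by ring
  simp only [h]
  rw [intervalIntegral.integral_finsetSum
    fun j _ => Continuous.intervalIntegrable (by fun_prop) _ _]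
  simp only [intervalIntegral.integral_const_mul, integral_half_add_pow]
  refine Finset.sum_congr rfl fun j _ => ?_
  push_cast
  ring

/-- Written in `s`, a polynomial of `A^n` has no constant term, as it vanishes at `s = 0`, and its
coefficients sum to zero, as it vanishes at `s = 1`. Only the moments of index `1` to `n` enter; the
one of index `0` is left free. -/
theorem integral_rampFun_mul_eq_zero {n : ℕ} {d : ℕ → ℝ} {K : ℝ}
    (hK : ∀ k, 1 ≤ k → k ≤ n → ∫ t in (-1 : ℝ)..1, ((1 + t) / 2) ^ k * rampFun n d t = K)
    {q : Polynomial ℝ} (hq : q ∈ bubblePoly n) :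
    ∫ t in (-1 : ℝ)..1, rampFun n d t * q.eval t = 0 := by
  have hc := continuous_rampFun n d
  have hm : q.eval (-1) = 0 := hq.1.2
  have hp : q.eval 1 = 0 := hq.2
  set Q : Polynomial ℝ := q.comp (Polynomial.C 2 * Polynomial.X - 1) with hQ
  have hQe : ∀ s, Q.eval s = q.eval (2 * s - 1) := fun s => by simp [hQ]
  have hQd : Q.natDegree < n + 1 := by
    have h1 : (Polynomial.C (2 : ℝ) * Polynomial.X - 1).natDegree ≤ 1 := by compute_degree
    have h2 := Polynomial.natDegree_le_of_degree_le (Polynomial.mem_degreeLE.1 hq.1.1)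
    have h3 := Polynomial.natDegree_comp_le (p := q) (q := Polynomial.C 2 * Polynomial.X - 1)
    rw [← hQ] at h3
    nlinarith
  have h0 : Q.coeff 0 = 0 := by
    rw [Polynomial.coeff_zero_eq_eval_zero, hQe, mul_zero, zero_sub, hm]
  have h1 : ∑ i ∈ Finset.range (n + 1), Q.coeff i = 0 := by
    have h2 : Q.eval 1 = 0 := by
      rw [hQe, ← hp]
      norm_num
    rw [Polynomial.eval_eq_sum_range' hQd] at h2
    simpa using h2
  have h2 : ∀ t : ℝ, rampFun n d t * q.eval t =
      ∑ i ∈ Finset.range (n + 1), Q.coeff i * (((1 + t) / 2) ^ i * rampFun n d t) := fun t => by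
    have h3 : q.eval t = Q.eval ((1 + t) / 2) := by
      rw [hQe]
      ring_nf
    rw [h3, Polynomial.eval_eq_sum_range' hQd, Finset.mul_sum]
    exact Finset.sum_congr rfl fun i _ => by ring
  have h3 : ∀ i ∈ Finset.range (n + 1),
      Q.coeff i * ∫ t in (-1 : ℝ)..1, ((1 + t) / 2) ^ i * rampFun n d t = Q.coeff i * K := by
    intro i hi
    rcases Nat.eq_zero_or_pos i with rfl | hi0
    · rw [h0, zero_mul, zero_mul]
    · rw [hK i hi0 (Nat.lt_succ_iff.1 (Finset.mem_range.1 hi))]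
  simp only [h2]
  rw [intervalIntegral.integral_finsetSum
    fun i _ => Continuous.intervalIntegrable (by fun_prop) _ _]
  simp only [intervalIntegral.integral_const_mul]
  rw [Finset.sum_congr rfl h3, ← Finset.sum_mul, h1, zero_mul]

/-- The difference between `1 + t` and the ramp lies in `A^n`: both vanish at `-1`, since only
positive powers of `s` occur, and both equal `2` at `1`. -/
theorem rightRamp_eq_cutL2 {n : ℕ} (hn : 1 ≤ n) {d : ℕ → ℝ}
    (hd : ∑ j ∈ Finset.range n, d j = 2) {K : ℝ}
    (hK : ∀ k, 1 ≤ k → k ≤ n → ∫ t in (-1 : ℝ)..1, ((1 + t) / 2) ^ k * rampFun n d t = K) :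
    rightRamp n = cutL2 (rampFun n d) (continuous_rampFun n d) := by
  set p : Polynomial ℝ := 1 + Polynomial.X - ∑ j ∈ Finset.range n,
    Polynomial.C (d j) * (Polynomial.C (1 / 2) * (1 + Polynomial.X)) ^ (j + 1) with hp
  have hpe : ∀ t, p.eval t = 1 + t - rampFun n d t := fun t => by
    rw [hp, rampFun]
    simp only [Polynomial.eval_sub, Polynomial.eval_add, Polynomial.eval_one, Polynomial.eval_X,
      Polynomial.eval_finsetSum, Polynomial.eval_mul, Polynomial.eval_C, Polynomial.eval_pow]
    congr 1
    exact Finset.sum_congr rfl fun j _ => by ring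
  refine subProj_cutL2 (p := p) _ _ ?_ (fun t => by rw [hpe]; ring)
    fun q hq => integral_rampFun_mul_eq_zero hK hq
  refine ⟨⟨?_, ?_⟩, ?_⟩
  · refine Submodule.sub_mem _ ?_ (Submodule.sum_mem _ fun j hj => ?_)
    · rw [Polynomial.mem_degreeLE]
      refine Polynomial.degree_le_of_natDegree_le (le_trans ?_ hn)
      compute_degree
    · rw [Polynomial.mem_degreeLE]
      refine Polynomial.degree_le_of_natDegree_le ?_
      refine (Polynomial.natDegree_C_mul_le _ _).trans ?_
      have h1 : (Polynomial.C (1 / 2 : ℝ) * (1 + Polynomial.X)).natDegree ≤ 1 := by compute_degree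
      have h2 := Polynomial.natDegree_pow_le_of_le (j + 1) h1
      have h3 := Finset.mem_range.1 hj
      omega
  · change p.eval (-1) = 0
    rw [hpe, rampFun]
    simp
  · change p.eval 1 = 0
    rw [hpe, rampFun]
    norm_num [hd]

/-- Poles `-(j + 2)` and zeros `j + 1` give residues with sum `∑ (2 j + 3) = n (n + 2)`; the value
`2` at `t = 1` then fixes `K`. -/
theorem exists_rightRamp_eq {n : ℕ} (hn : 1 ≤ n) :
    ∃ d : ℕ → ℝ, rightRamp n = cutL2 (rampFun n d) (continuous_rampFun n d) ∧
      ∀ k : ℕ, ∫ t in (-1 : ℝ)..1, ((1 + t) / 2) ^ k * rampFun n d t =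
        4 / (n * (n + 2)) * (1 - (∏ i ∈ Finset.range n, ((k : ℝ) - (i + 1))) /
          ∏ i ∈ Finset.range n, ((k : ℝ) + 2 + i)) := by
  have hnR : (n : ℝ) ≠ 0 := by
    have : n ≠ 0 := by omega
    exact_mod_cast this
  set K : ℝ := 4 / (n * (n + 2)) with hK
  obtain ⟨c, hc1, hc2, -⟩ := exists_partialFraction (Finset.range n)
    (fun j => (j : ℝ) + 2) (fun j => (j : ℝ) + 1) (fun i _ j _ h => by simpa using h)
  have hmom : ∀ k : ℕ, ∫ t in (-1 : ℝ)..1,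
        ((1 + t) / 2) ^ k * rampFun n (fun j => K * c j / 2) t =
      K * (1 - (∏ i ∈ Finset.range n, ((k : ℝ) - (i + 1))) /
          ∏ i ∈ Finset.range n, ((k : ℝ) + 2 + i)) := by
    intro k
    have h1 := hc1 k fun j _ => by positivity
    have h2 : ∏ j ∈ Finset.range n, ((k : ℝ) + (j + 2)) = ∏ i ∈ Finset.range n, ((k : ℝ) + 2 + i) :=
      Finset.prod_congr rfl fun i _ => by ring
    rw [h2] at h1
    rw [integral_pow_mul_rampFun, ← h1, Finset.mul_sum]
    exact Finset.sum_congr rfl fun j _ => by ring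
  refine ⟨fun j => K * c j / 2, rightRamp_eq_cutL2 hn ?_ (K := K) ?_, hmom⟩
  · have h1 : ∑ j ∈ Finset.range n, c j = n * (n + 2) := by
      rw [hc2]
      simp only [Finset.sum_add_distrib, sum_range_cast, Finset.sum_const, Finset.card_range,
        nsmul_eq_mul]
      ring
    rw [← Finset.sum_div, ← Finset.mul_sum, h1, hK]
    field_simp
    norm_num
  · intro k hk1 hkn
    rw [hmom, Finset.prod_eq_zero (i := k - 1) (Finset.mem_range.2 (by omega))]
    · simp
    · rw [Nat.cast_sub hk1]
      simp

theorem hasSum_hyperF_ramp (n : ℕ) (z : ℂ) :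
    HasSum (fun k : ℕ => poch ((n : ℂ) + 1) k * poch ((n : ℂ) + 3) k /
        (poch ((n : ℂ) + 2) k * poch (2 * n + 3) k * k.factorial) * z ^ k)
      (hyperF [(n : ℂ) + 1, n + 3] [(n : ℂ) + 2, 2 * n + 3] z) := by
  have h := hasSum_hyperF [(n : ℂ) + 1, n + 3] [(n : ℂ) + 2, 2 * n + 3] z 1 fun i => ?_
  · simpa using h
  · have h1 : (n : ℂ) + 1 + i = ((n + 1 + i : ℕ) : ℂ) := by push_cast; ring
    have h2 : (n : ℂ) + 2 + i = ((n + 2 + i : ℕ) : ℂ) := by push_cast; ring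
    have h3 : (n : ℂ) + 3 + i = ((n + 3 + i : ℕ) : ℂ) := by push_cast; ring
    have h4 : 2 * (n : ℂ) + 3 + i = ((2 * n + 3 + i : ℕ) : ℂ) := by push_cast; ring
    simp only [List.map_cons, List.map_nil, List.prod_cons, List.prod_nil, mul_one, one_mul, h1,
      h2, h3, h4, Complex.norm_natCast]
    gcongr <;> omega

/-- The product vanishes only for `1 ≤ k ≤ n`. The surviving term `k = 0` is `(-1) ^ n / (n + 1)`,
and the terms from `k = n + 1` on form the `₂F₂`. -/
theorem hasSum_ramp_remainder (n : ℕ) (z : ℂ) :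
    HasSum (fun k : ℕ => z ^ k / k.factorial *
        ((∏ i ∈ Finset.range n, ((k : ℂ) - (i + 1))) / poch ((k : ℂ) + 2) n))
      ((-1) ^ n / (n + 1) + n.factorial * (n + 2) / (2 * n + 2).factorial * z ^ (n + 1) *
        hyperF [(n : ℂ) + 1, n + 3] [(n : ℂ) + 2, 2 * n + 3] z) := by
  have hf : ∀ k : ℕ, (k.factorial : ℂ) ≠ 0 := fun k => by exact_mod_cast k.factorial_ne_zero
  have hfirst : ∑ k ∈ Finset.range (n + 1), z ^ k / k.factorial *
      ((∏ i ∈ Finset.range n, ((k : ℂ) - (i + 1))) / poch ((k : ℂ) + 2) n) =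
      (-1) ^ n / (n + 1) := by
    rw [Finset.sum_range_succ', Finset.sum_eq_zero fun k hk => by
      rw [Finset.prod_eq_zero hk (by push_cast; ring)]
      simp]
    have h1 : ∏ i ∈ Finset.range n, (((0 : ℕ) : ℂ) - (i + 1)) = (-1) ^ n * n.factorial := by
      rw [← Finset.prod_range_add_one_eq_factorial]
      simp only [Nat.cast_zero, zero_sub]
      rw [Finset.prod_neg, Finset.card_range]
      push_cast
      rfl
    have h2 := poch_natCast 1 n
    rw [add_comm 1 n, Nat.factorial_one, Nat.factorial_succ n, Nat.cast_one, mul_one] at h2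
    have h3 : ((0 : ℕ) : ℂ) + 2 = 1 + 1 := by norm_num
    rw [h1, h3, h2]
    have h4 : (n : ℂ) + 1 ≠ 0 := by exact_mod_cast n.succ_ne_zero
    have h5 := hf n
    push_cast
    field_simp
    simp
  rw [add_comm, ← hfirst, ← hasSum_nat_add_iff]
  have hcoeff : ∀ j : ℕ, z ^ (j + (n + 1)) / (j + (n + 1)).factorial *
      ((∏ i ∈ Finset.range n, (((j + (n + 1) : ℕ) : ℂ) - (i + 1))) /
        poch (((j + (n + 1) : ℕ) : ℂ) + 2) n) =
      n.factorial * (n + 2) / (2 * n + 2).factorial * z ^ (n + 1) *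
        (poch ((n : ℂ) + 1) j * poch ((n : ℂ) + 3) j /
        (poch ((n : ℂ) + 2) j * poch (2 * n + 3) j * j.factorial) * z ^ j) := by
    intro j
    have h1 : (∏ i ∈ Finset.range n, (((j + (n + 1) : ℕ) : ℂ) - (i + 1))) =
        (n + j).factorial / j.factorial := by
      rw [eq_div_iff (hf j)]
      have h := congrArg (fun x : ℝ => (x : ℂ)) (prod_range_cast_sub_mul_factorial j n)
      push_cast at h
      rw [add_comm n j, ← h]
      congr 1
      refine Finset.prod_congr rfl fun i _ => ?_
      push_cast
      ring
    have hp : ∀ (x : ℂ) (a k : ℕ), x = (a : ℂ) + 1 →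
        poch x k = (a + k).factorial / a.factorial := fun x a k hx => by
      rw [hx, eq_div_iff (hf a), poch_natCast]
    rw [h1, hp _ (n + 2 + j) n (by push_cast; ring), hp _ n j rfl,
      hp _ (n + 2) j (by push_cast; ring), hp _ (n + 1) j (by push_cast; ring),
      hp _ (2 * n + 2) j (by push_cast; ring)]
    have e1 : n + 2 + j + n = 2 * n + 2 + j := by ring
    have e2 : j + (n + 1) = n + 1 + j := by ring
    have e3 : ((n + 2).factorial : ℂ) = (n + 2) * (n + 1).factorial := by
      rw [Nat.factorial_succ]
      push_cast
      ring
    have h2 : (n : ℂ) + 2 ≠ 0 := by exact_mod_cast (n + 1).succ_ne_zero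
    rw [e1, e2, e3]
    have := hf n
    have := hf j
    have := hf (n + 1)
    have := hf (n + j)
    have := hf (n + 1 + j)
    have := hf (n + 2 + j)
    have := hf (2 * n + 2)
    have := hf (2 * n + 2 + j)
    field_simp
    ring
  simp only [hcoeff]
  exact (hasSum_hyperF_ramp n z).mul_left _

theorem fourierT_leftRamp {n : ℕ} (w : ℝ) (hn : 1 ≤ n) :
    fourierT (leftRamp n) w =
      4 / (n * (n + 2)) * cexp (I * w)
        - 4 * (-1) ^ n * cexp (-I * w) / (n * (n + 1) * (n + 2))
        - 4 * ((n - 1).factorial : ℂ) * (2 * I * w) ^ (n + 1) * cexp (-I * w)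
            / ((2 * n + 2).factorial : ℂ)
            * hyperF [(n : ℂ) + 1, n + 3] [(n : ℂ) + 2, 2 * n + 3] (2 * I * w) := by
  obtain ⟨d, hd, hmom⟩ := exists_rightRamp_eq hn
  have hflip : fourierT (leftRamp n) w = fourierT (rightRamp n) (-w) := by
    rw [fourierT, fourierT, ← integral_neg_eq_self]
    refine integral_congr_ae (Filter.Eventually.of_forall fun t => ?_)
    simp [leftRamp]
  have hae : rightRamp n =ᵐ[volume] (Icc (-1 : ℝ) 1).indicator (rampFun n d) := by
    rw [hd]
    exact cutL2_ae_eq _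
  -- Since `t = 2 s - 1`, the kernel `e^{iwt}` equals `e^{-iw} e^{2iws}`, which makes the moments in
  -- `s` applicable.
  have hexp : ∀ t : ℝ, cexp (-I * (-w : ℝ) * t) * (rampFun n d t : ℂ) =
      cexp (-I * w) * (cexp (2 * I * w * ((1 + t) / 2 : ℝ)) * (rampFun n d t : ℂ)) := fun t => by
    rw [← mul_assoc, ← Complex.exp_add]
    congr 2
    push_cast
    ring
  rw [hflip, fourierT_of_ae_eq hae]
  simp only [hexp]
  rw [intervalIntegral.integral_const_mul]
  have hsum := hasSum_integral_exp (2 * I * w) (h := fun t : ℝ => (1 + t) / 2) (by fun_prop)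
    (continuous_rampFun n d)
  simp only [hmom] at hsum
  have hE : HasSum (fun k : ℕ => (2 * I * w) ^ k / k.factorial) (cexp (2 * I * w)) := by
    rw [Complex.exp_eq_exp_ℂ]
    exact NormedSpace.expSeries_div_hasSum_exp _
  have key := (hE.mul_left (4 / (n * (n + 2)) : ℂ)).sub
    ((hasSum_ramp_remainder n (2 * I * w)).mul_left (4 / (n * (n + 2)) : ℂ))
  have hP : ∀ k : ℕ, ((∏ i ∈ Finset.range n, ((k : ℝ) + 2 + i) : ℝ) : ℂ) =
      poch ((k : ℂ) + 2) n := fun k => by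
    rw [poch]
    push_cast
    rfl
  have heq := hsum.unique (by
    convert! key using 1
    funext k
    rw [Complex.ofReal_mul, Complex.ofReal_sub, Complex.ofReal_div, Complex.ofReal_div, hP]
    push_cast
    ring)
  have h1 : cexp (I * w) = cexp (-I * w) * cexp (2 * I * w) := by
    rw [← Complex.exp_add]
    congr 1
    ring
  have h2 : (n.factorial : ℂ) = n * (n - 1).factorial := by
    exact_mod_cast (Nat.mul_factorial_pred (by omega)).symm
  have h3 : (n : ℂ) ≠ 0 := by
    have : n ≠ 0 := by omega
    exact_mod_cast this
  have h4 : (n : ℂ) + 1 ≠ 0 := by exact_mod_cast n.succ_ne_zero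
  have h5 : (n : ℂ) + 2 ≠ 0 := by exact_mod_cast (n + 1).succ_ne_zero
  have h6 : ((2 * n + 2).factorial : ℂ) ≠ 0 := by exact_mod_cast (2 * n + 2).factorial_ne_zero
  rw [heq, h1, h2]
  field_simp
  ring

/-! ### The functions `u^0_{n,j}` -/

theorem uBarFormula_eq (m : ℕ) {ε : ℕ} (hε : ε = 0 ∨ ε = 1) (t : ℝ) :
    uBarFormula (2 * m + 1 + ε) t = t ^ ε - |t| * t ^ (2 * m + ε) := by
  rcases hε with rfl | rfl
  · simp [uBarFormula]
  · have h : ¬ Odd (2 * m + 1 + 1) := by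
      rw [Nat.not_odd_iff_even]
      exact (odd_two_mul_add_one m).add_one
    simp [uBarFormula, h]

theorem uZero_eq_cutL2 {m n ε : ℕ} (hmn : m ≤ n) (hε : ε = 0 ∨ ε = 1) {d : ℕ → ℝ}
    (hd : ∑ j ∈ Finset.range (n + 1), d j = 1) {K : ℝ}
    (hK : ∀ k ≤ n, ∫ t in (-1 : ℝ)..1,
      t ^ (2 * k + ε) * parityFun (Finset.range (n + 1)) d 1 m ε t = K) :
    uZero (2 * n + 1 + ε) (2 * n - 2 * m) =
      cutL2 (parityFun (Finset.range (n + 1)) d 1 m ε) (continuous_parityFun _ _ _ _ _) := by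
  set p : Polynomial ℝ := Polynomial.X ^ ε - ∑ j ∈ Finset.range (n + 1),
    Polynomial.C (d j) * Polynomial.X ^ (2 * j + ε) with hp
  have hpe : ∀ t, p.eval t = t ^ ε - ∑ j ∈ Finset.range (n + 1), d j * t ^ (2 * j + ε) :=
    fun t => by simp [hp, Polynomial.eval_finsetSum]
  -- The second index of `uZero` is the order minus the index of `uBar`; `m ≤ n` keeps the natural
  -- subtraction exact.
  have hM : 2 * n + 1 + ε - (2 * n - 2 * m) = 2 * m + 1 + ε := by omega
  rw [uZero, hM, uBar]
  refine subProj_cutL2 (p := p) _ _ ?_ (fun t => ?_) fun q hq =>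
    integral_mul_eq_zero_of_mem_bubblePoly hε (continuous_parityFun _ _ _ _ _)
      (fun k hk => integral_pow_mul_parityFun_of_odd _ _ _ _ hk) hK hq
  · refine ⟨⟨Submodule.sub_mem _ ?_ (Submodule.sum_mem _ fun j hj => ?_), ?_⟩, ?_⟩
    · rw [Polynomial.mem_degreeLE, Polynomial.degree_X_pow]
      exact_mod_cast (by omega : ε ≤ 2 * n + 1 + ε)
    · rw [Polynomial.mem_degreeLE]
      refine (Polynomial.degree_C_mul_X_pow_le _ _).trans ?_
      have := Finset.mem_range.1 hj
      exact_mod_cast (by omega : 2 * j + ε ≤ 2 * n + 1 + ε)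
    · change p.eval (-1) = 0
      rw [hpe]
      simp [pow_add, pow_mul, ← Finset.sum_mul, hd]
    · change p.eval 1 = 0
      rw [hpe]
      simp [hd]
  · rw [uBarFormula_eq m hε, hpe, parityFun]
    ring

theorem exists_uZero_eq {m n ε : ℕ} (hmn : m ≤ n) (hε : ε = 0 ∨ ε = 1) :
    ∃ d : ℕ → ℝ, uZero (2 * n + 1 + ε) (2 * n - 2 * m) =
        cutL2 (parityFun (Finset.range (n + 1)) d 1 m ε) (continuous_parityFun _ _ _ _ _) ∧
      ∀ k : ℕ, ∫ t in (-1 : ℝ)..1,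
          t ^ (2 * k + ε) * parityFun (Finset.range (n + 1)) d 1 m ε t =
        (-1) ^ (n + 1) * (∏ i ∈ Finset.range (n + 1), (-(m : ℝ) - 1 / 2 + i)) /
            ((∏ i ∈ Finset.range (n + 1), ((m : ℝ) + 1 + ε + i)) *
              ((n + 1) * (1 / 2 + ε + n))) *
          (1 - (∏ i ∈ Finset.range (n + 1), ((k : ℝ) - i)) *
              (k + m + ε + 1 + (n + 1) * (1 / 2 + ε + n)) /
            ((∏ i ∈ Finset.range (n + 1), ((k : ℝ) + ε + 1 / 2 + i)) * (k + m + ε + 1))) := by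
  set R : ℝ := ∏ i ∈ Finset.range (n + 1), (-(m : ℝ) - 1 / 2 + i) with hR
  set Q : ℝ := ∏ i ∈ Finset.range (n + 1), ((m : ℝ) + 1 + ε + i) with hQ
  set K : ℝ := (-1) ^ (n + 1) * R / (Q * ((n + 1) * (1 / 2 + ε + n))) with hK
  -- Again `β` makes `∑ (a j + b j)` vanish, and `K` normalises the coefficient of the term with
  -- `|t|` to `-1`. The other coefficients then sum to `1`, as the boundary values require.
  set β : ℝ := -(m + ε + 1 + (n + 1) * (1 / 2 + ε + n)) with hβ
  have hQ0 : Q ≠ 0 := (Finset.prod_pos fun i _ => by positivity).ne'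
  set a : ℕ → ℝ := fun j => if j < n + 1 then (j : ℝ) + ε + 1 / 2 else m + ε + 1 with ha
  set b : ℕ → ℝ := fun j => if j < n + 1 then (j : ℝ) else β with hb
  have han : a (n + 1) = m + ε + 1 := by simp [ha]
  have hbn : b (n + 1) = β := by simp [hb]
  have haj : ∀ j ∈ Finset.range (n + 1), a j = j + ε + 1 / 2 := fun j hj => by
    simp only [ha, if_pos (Finset.mem_range.1 hj)]
  have hbj : ∀ j ∈ Finset.range (n + 1), b j = j := fun j hj => by
    simp only [hb, if_pos (Finset.mem_range.1 hj)]
  have hne : ∀ i : ℕ, (i : ℝ) + ε + 1 / 2 ≠ m + ε + 1 := fun i h => by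
    have h1 : (2 * i + 1 : ℝ) = 2 * m + 2 := by linarith
    have h2 : 2 * i + 1 = 2 * m + 2 := by exact_mod_cast h1
    omega
  have hapos : ∀ j, 0 < a j := fun j => by
    simp only [ha]
    split_ifs <;> positivity
  have hinj : Set.InjOn a (Finset.range (n + 2)) := by
    intro i hi j hj h
    have hi' : i < n + 2 := by simpa using hi
    have hj' : j < n + 2 := by simpa using hj
    simp only [ha] at h
    split_ifs at h with h1 h2 h2
    · exact injOn_add_half ε Set.univ trivial trivial h
    · exact absurd h (hne i)
    · exact absurd h.symm (hne j)
    · omega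
  obtain ⟨c, hc1, hc2, hc3⟩ := exists_partialFraction (Finset.range (n + 2)) a b hinj
  have hprod : ∀ x : ℝ, ∏ j ∈ Finset.range (n + 2), (x - b j) =
      (∏ j ∈ Finset.range (n + 1), (x - j)) * (x - β) := fun x => by
    rw [Finset.prod_range_succ, hbn]
    congr 1
    exact Finset.prod_congr rfl fun j hj => by rw [hbj j hj]
  have hlead : K * c (n + 1) = -1 := by
    have h1 := hc3 (n + 1) (Finset.self_mem_range_succ _)
    have h2 : ∏ i ∈ (Finset.range (n + 2)).erase (n + 1), (a i - a (n + 1)) = R := by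
      rw [Finset.range_add_one, Finset.erase_insert Finset.notMem_range_self, han]
      exact Finset.prod_congr rfl fun i hi => by rw [haj i hi]; ring
    have h3 : ∏ i ∈ Finset.range (n + 1), ((m : ℝ) + ε + 1 + i) = Q :=
      Finset.prod_congr rfl fun i _ => by ring
    have h4 : ((-1 : ℝ) ^ (n + 1)) * (-1) ^ (n + 1) = 1 := by
      rw [← pow_add, (Even.add_self _).neg_one_pow]
    rw [h2, hprod, han, prod_range_neg_sub, h3, hβ] at h1
    rw [hK, div_mul_eq_mul_div, div_eq_iff (by positivity)]
    linear_combination (-1 : ℝ) ^ (n + 1) * h1 - (Q * ((n + 1) * (1 / 2 + ε + n))) * h4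
  have hmom : ∀ k : ℕ, ∫ t in (-1 : ℝ)..1,
        t ^ (2 * k + ε) * parityFun (Finset.range (n + 1)) (fun j => K * c j) 1 m ε t =
      K * (1 - (∏ i ∈ Finset.range (n + 1), ((k : ℝ) - i)) *
          (k + m + ε + 1 + (n + 1) * (1 / 2 + ε + n)) /
        ((∏ i ∈ Finset.range (n + 1), ((k : ℝ) + ε + 1 / 2 + i)) * (k + m + ε + 1))) := by
    intro k
    have h1 := hc1 k fun j _ => (add_pos_of_nonneg_of_pos k.cast_nonneg (hapos j)).ne'
    have h2 : ∏ j ∈ Finset.range (n + 2), ((k : ℝ) + a j) =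
        (∏ i ∈ Finset.range (n + 1), ((k : ℝ) + ε + 1 / 2 + i)) * (k + m + ε + 1) := by
      rw [Finset.prod_range_succ, han]
      congr 1
      · exact Finset.prod_congr rfl fun i hi => by rw [haj i hi]; ring
      · ring
    have h3 : (k : ℝ) - β = k + m + ε + 1 + (n + 1) * (1 / 2 + ε + n) := by rw [hβ]; ring
    rw [hprod, h2, h3] at h1
    rw [integral_pow_mul_parityFun_of_even, ← h1, Finset.sum_range_succ _ (n + 1), mul_add,
      Finset.mul_sum, sub_eq_add_neg, han, ← mul_div_assoc, hlead, neg_div]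
    congr 1
    exact Finset.sum_congr rfl fun j hj => by rw [haj j hj, mul_div_assoc]
  have hsum : ∑ j ∈ Finset.range (n + 2), c j = 0 := by
    rw [hc2, Finset.sum_range_succ, han, hbn, Finset.sum_add_distrib, Finset.sum_congr rfl haj,
      Finset.sum_congr rfl hbj, Finset.sum_add_distrib, Finset.sum_add_distrib, sum_range_cast]
    simp only [Finset.sum_const, Finset.card_range, nsmul_eq_mul, hβ]
    push_cast
    ring
  refine ⟨fun j => K * c j, uZero_eq_cutL2 hmn hε ?_ (K := K) ?_, hmom⟩
  · rw [Finset.sum_range_succ] at hsum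
    rw [← Finset.mul_sum]
    linear_combination K * hsum - hlead
  · intro k hk
    rw [hmom, prod_range_cast_sub_eq_zero (Nat.lt_succ_of_le hk)]
    simp

/-- This passes from the symbols `(1/2)_{k + ε}` of the moment series to the form `(1/2 + ε)_k`. -/
theorem poch_half_add (k : ℕ) {ε : ℕ} (hε : ε = 0 ∨ ε = 1) :
    2 ^ ε * poch (1 / 2) (k + ε) = poch (1 / 2 + ε) k := by
  rcases hε with rfl | rfl
  · simp
  · rw [poch_succ']
    push_cast
    ring

/-- This is the series of `hasSum_cos_sub`, with its sum expressed as a `₀F₁`. -/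
theorem hasSum_fourier_zero_one {ε : ℕ} (hε : ε = 0 ∨ ε = 1) (w : ℂ) :
    HasSum (fun k : ℕ => (-I * w) ^ (2 * k + ε) / (2 * k + ε).factorial)
      ((-I * w) ^ ε * hyperF [] [1 / 2 + (ε : ℂ)] (-(w / 2) ^ 2)) := by
  have h := (hasSum_hyperF_zero_one (b := 1 / 2 + (ε : ℝ)) (by simp)
    (-(w / 2) ^ 2)).mul_left ((-I * w) ^ ε)
  push_cast at h
  convert! h using 1
  funext k
  have h1 : poch (1 / 2 + ε) k ≠ 0 := by
    rw [add_comm]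
    exact poch_half_ne_zero ε k
  have h2 : (k.factorial : ℂ) ≠ 0 := by exact_mod_cast k.factorial_ne_zero
  have h3 : ((2 * k + ε).factorial : ℂ) = 4 ^ k * k.factorial * poch (1 / 2 + ε) k := by
    rw [factorial_two_mul_add _ hε, ← poch_half_add k hε, pow_add, pow_mul]
    ring
  have h4 : (-I * w) ^ (2 * k + ε) = (-I * w) ^ ε * (4 ^ k * (-(w / 2) ^ 2) ^ k) := by
    have h5 : (-I * w) ^ 2 = 4 * -(w / 2) ^ 2 := by
      rw [mul_pow, neg_sq, I_sq]
      ring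
    rw [pow_add, pow_mul, h5, mul_pow 4, mul_comm]
  rw [h3, h4]
  field_simp

/-- The quotient `(a)_k / (a + 1)_k` telescopes to `a / (a + k)`, so a `₁F₂` of this shape is a
`₀F₁` with one extra simple pole in its terms. -/
theorem hasSum_hyperF_one_two {a b : ℝ} (ha : 0 < a) (hb : 1 / 2 ≤ b) (z : ℂ) :
    HasSum (fun k : ℕ => a / (a + k) * (1 / (poch b k * k.factorial) * z ^ k))
      (hyperF [(a : ℂ)] [(a : ℂ) + 1, (b : ℂ)] z) := by
  have h := hasSum_hyperF [(a : ℂ)] [(a : ℂ) + 1, (b : ℂ)] z 2 fun i => ?_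
  · simp only [List.map_cons, List.map_nil, List.prod_cons, List.prod_nil, mul_one] at h
    convert! h using 1
    funext k
    have h1 : poch (a : ℂ) k * (a + k) = a * poch (a + 1) k := by rw [← poch_succ, poch_succ']
    have h2 : (a : ℂ) + k ≠ 0 := by
      have : a + k ≠ 0 := by positivity
      exact_mod_cast this
    have h3 : poch ((a : ℂ) + 1) k ≠ 0 := by
      simpa using poch_ne_zero (a := a + 1) (by positivity) k
    have h4 := poch_ne_zero (a := b) (by linarith) k
    have h5 : (k.factorial : ℂ) ≠ 0 := by exact_mod_cast k.factorial_ne_zero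
    have h6 : (a : ℂ) / (a + k) = poch (a : ℂ) k / poch (a + 1) k := by
      rw [div_eq_div_iff h2 h3, ← h1]
    rw [h6]
    field_simp
  · have hn : ∀ x : ℝ, 0 ≤ x → ‖(x : ℂ) + i‖ = x + i := fun x hx => by
      rw [← Complex.ofReal_natCast, ← Complex.ofReal_add, Complex.norm_real, Real.norm_of_nonneg]
      positivity
    have h1 : (a : ℂ) + 1 = ((a + 1 : ℝ) : ℂ) := by push_cast; rfl
    simp only [List.map_cons, List.map_nil, List.prod_cons, List.prod_nil, mul_one, h1]
    rw [hn a ha.le, hn (a + 1) (by positivity), hn b (by linarith)]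
    have h2 : (0 : ℝ) ≤ i := Nat.cast_nonneg i
    nlinarith [mul_nonneg (by positivity : (0 : ℝ) ≤ a + 1 + i) (by linarith : 0 ≤ b + i - 1 / 2)]

theorem hasSum_fourier_remainder_div (m n : ℕ) {ε : ℕ} (hε : ε = 0 ∨ ε = 1) (w : ℂ) :
    HasSum (fun k : ℕ => (-I * w) ^ (2 * k + ε) / (2 * k + ε).factorial *
        ((∏ i ∈ Finset.range (n + 1), ((k : ℂ) - i)) / poch ((k : ℂ) + ε + 1 / 2) (n + 1)) *
        (1 / (k + m + ε + 1)))
      ((-1) ^ (n + 1) * (-I) ^ ε / poch (1 / 2) (2 * n + 2 + ε) * (w / 2) ^ (2 * n + 2 + ε) *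
        (1 / (n + m + ε + 2)) *
        hyperF [(n : ℂ) + m + ε + 2] [(n : ℂ) + m + ε + 3, 2 * n + 5 / 2 + ε] (-(w / 2) ^ 2)) := by
  refine hasSum_of_hasSum_shift (n + 1) (fun k hk => ?_) ?_
  · rw [Finset.prod_eq_zero (Finset.mem_range.2 hk) (sub_self _)]
    simp
  · have h := (hasSum_hyperF_one_two (a := (n : ℝ) + m + ε + 2) (b := 2 * n + 5 / 2 + ε)
      (by positivity) (by
        have h1 : (0 : ℝ) ≤ n := Nat.cast_nonneg n
        have h2 : (0 : ℝ) ≤ ε := Nat.cast_nonneg ε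
        linarith) (-(w / 2) ^ 2)).mul_left ((-1) ^ (n + 1) * (-I) ^ ε /
          poch (1 / 2) (2 * n + 2 + ε) * (w / 2) ^ (2 * n + 2 + ε) * (1 / (n + m + ε + 2)))
    push_cast at h
    have e1 : (n : ℂ) + m + ε + 2 + 1 = n + m + ε + 3 := by ring
    rw [e1] at h
    convert! h using 1
    funext j
    have e2 : (((n + 1 + n + 1 + ε : ℕ) : ℂ) + 1 / 2) = 2 * n + 5 / 2 + ε := by
      push_cast
      ring
    have e3 : ((j + (n + 1) : ℕ) : ℂ) + m + ε + 1 = n + m + ε + 2 + j := by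
      push_cast
      ring
    have h1 : (n : ℂ) + m + ε + 2 ≠ 0 := by exact_mod_cast (n + m + ε + 1).succ_ne_zero
    rw [fourier_coeff_eq _ _ _ hε, e2, e3, (by ring : n + 1 + n + 1 + ε = 2 * n + 2 + ε),
      (by ring : 2 * (n + 1) + ε = 2 * n + 2 + ε)]
    field_simp

theorem fourierT_uZero {m n ε : ℕ} (w : ℝ) (hmn : m ≤ n) (hε : ε = 0 ∨ ε = 1) :
    fourierT (uZero (2 * n + 1 + ε) (2 * n - 2 * m)) w =
      -(-I * w) ^ ε * poch (-m - 1 / 2) (n + 1)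
            / (poch (m + ε + 1) (n + 2) * poch (1 / 2 + ε) (2 * n + 2))
            * ((w : ℂ) / 2) ^ (2 * n + 2)
            * hyperF [(n : ℂ) + m + ε + 2] [(n : ℂ) + m + ε + 3, 2 * n + 5 / 2 + ε]
                (-((w : ℂ) / 2) ^ 2)
        - (-I * w) ^ ε * ((-1) ^ n * poch (-m - 1 / 2) (n + 1))
            / (poch (m + 1 + ε) (n + 1) * (n + 1) * (1 / 2 + ε + n))
            * hyperF [] [1 / 2 + (ε : ℂ)] (-((w : ℂ) / 2) ^ 2)
        - (-I * w) ^ ε * poch (-m - 1 / 2) (n + 1)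
            / ((n + 1) * (1 / 2 + ε + n) * poch (m + 1 + ε) (n + 1)
                * poch (1 / 2 + ε) (2 * n + 2))
            * ((w : ℂ) / 2) ^ (2 * n + 2)
            * hyperF [] [2 * n + 5 / 2 + (ε : ℂ)] (-((w : ℂ) / 2) ^ 2) := by
  obtain ⟨d, hd, hmom⟩ := exists_uZero_eq hmn hε
  have hae : uZero (2 * n + 1 + ε) (2 * n - 2 * m) =ᵐ[volume]
      (Icc (-1 : ℝ) 1).indicator (parityFun (Finset.range (n + 1)) d 1 m ε) := by
    rw [hd]
    exact cutL2_ae_eq _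
  have hsum := hasSum_fourierT_of_parity hε (continuous_parityFun _ _ _ _ _) hae
    (fun k hk => integral_pow_mul_parityFun_of_odd _ _ _ _ hk) w
  simp only [hmom] at hsum
  refine hsum.unique ?_
  set R : ℂ := poch (-m - 1 / 2) (n + 1) with hR
  set Q : ℂ := poch (m + 1 + ε) (n + 1) with hQ
  set K : ℂ := (-1) ^ (n + 1) * R / (Q * ((n + 1) * (1 / 2 + ε + n))) with hK
  -- The numerator factor `k - β` is `(k + m + ε + 1) + (n + 1)(1/2 + ε + n)`. The first part
  -- cancels the pole of the term with `|t|` and leaves a `₀F₁`; the second keeps that pole and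
  -- gives the `₁F₂`.
  have key := (((hasSum_fourier_zero_one hε w).mul_left K).sub
    ((hasSum_fourier_remainder (n + 1) n hε w).mul_left K)).sub
    ((hasSum_fourier_remainder_div m n hε w).mul_left (K * ((n + 1) * (1 / 2 + ε + n))))
  have hR' : ((∏ i ∈ Finset.range (n + 1), (-(m : ℝ) - 1 / 2 + i) : ℝ) : ℂ) = R := by
    rw [hR, poch]
    push_cast
    rfl
  have hQ' : ((∏ i ∈ Finset.range (n + 1), ((m : ℝ) + 1 + ε + i) : ℝ) : ℂ) = Q := by
    rw [hQ, poch]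
    push_cast
    rfl
  have hA : ∀ k : ℕ, ((∏ i ∈ Finset.range (n + 1), ((k : ℝ) + ε + 1 / 2 + i) : ℝ) : ℂ) =
      poch ((k : ℂ) + ε + 1 / 2) (n + 1) := fun k => by
    rw [poch]
    push_cast
    rfl
  have e1 : ((((n + 1 + n + 1 + ε : ℕ) : ℝ) + 1 / 2 : ℝ) : ℂ) = 2 * n + 5 / 2 + ε := by
    push_cast
    ring
  rw [e1, (by ring : n + 1 + n + 1 + ε = 2 * n + 2 + ε),
    (by ring : 2 * (n + 1) + ε = 2 * n + 2 + ε)] at key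
  convert! key using 1
  · funext k
    have h1 : (k : ℂ) + m + ε + 1 ≠ 0 := by exact_mod_cast (k + m + ε).succ_ne_zero
    have h2 : poch ((k : ℂ) + ε + 1 / 2) (n + 1) ≠ 0 := by
      simpa using poch_half_ne_zero (k + ε) (n + 1)
    simp only [Complex.ofReal_mul, Complex.ofReal_div, Complex.ofReal_sub, hR', hQ', hA]
    push_cast
    rw [← hK]
    field_simp
    ring
  · have h1 : (n : ℂ) + 1 ≠ 0 := by exact_mod_cast n.succ_ne_zero
    have h2 : 1 / 2 + (ε : ℂ) + n ≠ 0 := by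
      have h := Complex.ofReal_ne_zero.2 (by positivity : (1 / 2 + (ε : ℝ) + n) ≠ 0)
      push_cast at h
      exact h
    have h3 : (n : ℂ) + m + ε + 2 ≠ 0 := by exact_mod_cast (n + m + ε + 1).succ_ne_zero
    have h4 : Q ≠ 0 := by
      simpa using poch_ne_zero (a := (m : ℝ) + 1 + ε) (by positivity) (n + 1)
    have h5 : poch (m + ε + 1) (n + 2) = Q * (n + m + ε + 2) := by
      rw [poch_succ, hQ, add_right_comm]
      push_cast
      ring
    have h6 : poch (1 / 2) (2 * n + 2 + ε) ≠ 0 := by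
      simpa using poch_half_ne_zero 0 (2 * n + 2 + ε)
    have h8 : (-I * w) ^ ε = (-I) ^ ε * (w / 2 : ℂ) ^ ε * 2 ^ ε := by
      rw [← mul_pow, ← mul_pow]
      congr 1
      ring
    have h9 : (2 : ℂ) ^ ε ≠ 0 := pow_ne_zero _ two_ne_zero
    rw [h5, ← poch_half_add _ hε, hK, h8, pow_add _ _ ε, pow_succ (-1 : ℂ) n]
    generalize (w / 2 : ℂ) ^ (2 * n + 2) = X, (w / 2 : ℂ) ^ ε = Y, (2 : ℂ) ^ ε = D at h9 ⊢
    generalize poch (1 / 2) (2 * n + 2 + ε) = T at h6 ⊢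
    generalize hyperF [(n : ℂ) + m + ε + 2] [(n : ℂ) + m + ε + 3, 2 * n + 5 / 2 + ε] _ = F₁,
      hyperF [] [2 * n + 5 / 2 + (ε : ℂ)] _ = F₂
    generalize 1 / 2 + (ε : ℂ) + n = H, (n : ℂ) + m + ε + 2 = G at h2 h3 ⊢
    -- Only a rational identity remains; the two values of `(-1) ^ n` account for the product of the
    -- sign in `K` with that of the shifted series.
    rcases neg_one_pow_eq_or ℂ n with h7 | h7 <;> rw [h7] <;> field_simp <;> ring

end Ramp

theorem mainTheorem7 :
    (∀ (n ε : ℕ) (w : ℝ), 1 ≤ n → (ε = 0 ∨ ε = 1) →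
      fourierT (bubble (2 * n + ε)) w =
        (-I) ^ ε * ((n - 1).factorial : ℂ) / poch (n - 1 / 2 + ε) (n + 1)
            * Complex.cos (w - ε * (Real.pi / 2))
          + (-1) ^ n * (-I) ^ ε * ((n - 1).factorial : ℂ)
              / (poch (n - 1 / 2 + ε) (n + 1) * poch (1 / 2) (2 * n + 2 + ε))
              * ((w : ℂ) / 2) ^ (2 * n + 2 + ε)
              * hyperF [] [2 * n + 5 / 2 + ε] (-((w : ℂ) / 2) ^ 2)
          + (-1) ^ (n - 1) * (-I) ^ ε * ((n - 1).factorial : ℂ) * (n + 1) * (n + 1 / 2 + ε)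
              / (poch (n - 1 / 2 + ε) (n + 1) * poch (1 / 2) (2 * n + 1 + ε))
              * ((w : ℂ) / 2) ^ (2 * n + ε)
              * hyperF [] [2 * n + 3 / 2 + ε] (-((w : ℂ) / 2) ^ 2)) ∧
    (∀ (n : ℕ) (w : ℝ), 1 ≤ n →
      fourierT (leftRamp n) w =
        4 / (n * (n + 2)) * cexp (I * w)
          - 4 * (-1) ^ n * cexp (-I * w) / (n * (n + 1) * (n + 2))
          - 4 * ((n - 1).factorial : ℂ) * (2 * I * w) ^ (n + 1) * cexp (-I * w)
              / ((2 * n + 2).factorial : ℂ)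
              * hyperF [(n : ℂ) + 1, n + 3] [(n : ℂ) + 2, 2 * n + 3] (2 * I * w)) ∧
    (∀ (m n ε : ℕ) (w : ℝ), m ≤ n → (ε = 0 ∨ ε = 1) →
      fourierT (uZero (2 * n + 1 + ε) (2 * n - 2 * m)) w =
        -(-I * w) ^ ε * poch (-m - 1 / 2) (n + 1)
              / (poch (m + ε + 1) (n + 2) * poch (1 / 2 + ε) (2 * n + 2))
              * ((w : ℂ) / 2) ^ (2 * n + 2)
              * hyperF [(n : ℂ) + m + ε + 2] [(n : ℂ) + m + ε + 3, 2 * n + 5 / 2 + ε]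
                  (-((w : ℂ) / 2) ^ 2)
          - (-I * w) ^ ε * ((-1) ^ n * poch (-m - 1 / 2) (n + 1))
              / (poch (m + 1 + ε) (n + 1) * (n + 1) * (1 / 2 + ε + n))
              * hyperF [] [1 / 2 + (ε : ℂ)] (-((w : ℂ) / 2) ^ 2)
          - (-I * w) ^ ε * poch (-m - 1 / 2) (n + 1)
              / ((n + 1) * (1 / 2 + ε + n) * poch (m + 1 + ε) (n + 1)
                  * poch (1 / 2 + ε) (2 * n + 2))
              * ((w : ℂ) / 2) ^ (2 * n + 2)
              * hyperF [] [2 * n + 5 / 2 + (ε : ℂ)] (-((w : ℂ) / 2) ^ 2)) := by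
  exact ⟨fun n ε w hn hε => fourierT_bubble w hn hε, fun n w hn => fourierT_leftRamp w hn,
    fun m n ε w hmn hε => fourierT_uZero w hmn hε⟩
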